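/- Let $n\ge 0$ and let $\Bbbk$ be a field whose characteristic is $0$ or greater than $n$. For a permutation $\sigma$ of $[n]=\{1,\dots,n\}$ set $\sigma(0)=0$ and \[\mathrm{Peak}(\sigma)=\{i\in\{1,\dots,n-1\}\mid \sigma(i-1)<\sigma(i)>\sigma(i+1)\}.\] A set of integers is sparse if it contains no two consecutive integers. Let $\mathfrak{P}_n$ be the linear span, in the group algebra $\Bbbk S_n$, of the elements \[P_F=\sum_{\sigma\in S_n,\ \mathrm{Peak}(\sigma)=F}\sigma ,\] where $F$ runs over the sparse subsets of $\{1,\dots,n-1\}$. Then $\mathfrak{P}_n$ is a unital subalgebra of $\Bbbk S_n$ (the peak algebra). Its Jacobson radical $\mathrm{rad}(\mathfrak{P}_n)$ is the smallest two-sided ideal with semisimple quotient, and the dimension over $\Bbbk$ of the maximal semisimple quotient $\mathfrak{P}_n/\mathrm{rad}(\mathfrak{P}_n)$ is the number of almost-odd partitions of $n$, that is, of partitions of $n$ with at most one even part (counted with multiplicity). Equivalently, \[\dim_{\Bbbk}\mathfrak{P}_n/\mathrm{rad}(\mathfrak{P}_n)=\sum_{j=0}^{\lfloor n/2\rfloor}p_o(n-2j),\]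 where $p_o(m)$ is the number of partitions of $m$ all of whose parts are odd. -/

import Mathlib

noncomputable section

namespace PeakAlgebra

/-- The word `σ(0) σ(1) ⋯ σ(n)` of a permutation of `[n]` in one-line notation, with the
convention `σ(0) = 0`; a permutation `σ` of `{1, …, n}` is given by a permutation of
`Fin n = {0, …, n - 1}`, so the letter in position `i + 1` is `σ i + 1`.
Positions beyond `n` get the value `0` and are never used. -/
def word {n : ℕ} (σ : Equiv.Perm (Fin n)) (i : ℕ) : ℕ :=
  if h : 1 ≤ i ∧ i ≤ n then (σ ⟨i - 1, by omega⟩ : ℕ) + 1 else 0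

/-- The peak set `Peak(σ) = {i ∈ [n - 1] | σ(i - 1) < σ(i) > σ(i + 1)}`, where `σ(0) = 0`. -/
def peakSet {n : ℕ} (σ : Equiv.Perm (Fin n)) : Finset ℕ :=
  (Finset.Icc 1 (n - 1)).filter
    fun i => word σ (i - 1) < word σ i ∧ word σ (i + 1) < word σ i

/-- A set of natural numbers is sparse if it does not contain two consecutive integers. -/
def IsSparse (F : Finset ℕ) : Prop :=
  ∀ i ∈ F, i + 1 ∉ F

variable (𝕜 : Type*) [Field 𝕜] (n : ℕ)

/-- The element `P_F` of the group algebra `𝕜 S_n`: the sum of all permutations with peak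
set `F`. -/
def peakSum (F : Finset ℕ) : MonoidAlgebra 𝕜 (Equiv.Perm (Fin n)) :=
  ∑ σ : Equiv.Perm (Fin n) with peakSet σ = F, MonoidAlgebra.of 𝕜 (Equiv.Perm (Fin n)) σ

/-- The linear span in `𝕜 S_n` of the elements `P_F`, for `F` a sparse subset of `[n - 1]`. -/
def peakSpace : Submodule 𝕜 (MonoidAlgebra 𝕜 (Equiv.Perm (Fin n))) :=
  Submodule.span 𝕜 {x | ∃ F ⊆ Finset.Icc 1 (n - 1), IsSparse F ∧ x = peakSum 𝕜 n F}

/-- The peak algebra, as a unital subalgebra of the group algebra `𝕜 S_n`. As a vector space it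
is the linear span `peakSpace 𝕜 n`: that this span contains `1` and is closed under multiplication
is a theorem, not a definition, so the algebra is introduced as the subalgebra generated by the
span, and the equality with the span has to be stated separately. -/
def peakAlgebra : Subalgebra 𝕜 (MonoidAlgebra 𝕜 (Equiv.Perm (Fin n))) :=
  Algebra.adjoin 𝕜 (peakSpace 𝕜 n : Set (MonoidAlgebra 𝕜 (Equiv.Perm (Fin n))))

/-- The partitions of `n` in which at most one part (counted with multiplicity) is even. -/
def almostOddPartitions : Finset n.Partition :=
  Finset.univ.filter fun p => (p.parts.filter fun i => Even i).card ≤ 1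

end PeakAlgebra

end

/-!
# The semisimple quotient of the peak algebra

The maximal semisimple quotient of the peak algebra is a product of copies of the field, one for
each almost-odd partition.

*Closure.* Exchanging two consecutive values of a permutation preserves its peak set unless the
exchange is blocked, and these exchanges connect any two permutations with the same peak set
(`MoveInvariant.eq_of_peakSet_eq`). So the span of the elements `P_F` consists of the functions on
`S_n` invariant under these exchanges. If an exchange is blocked in a factor `π` of a product `π ρ`,
it amounts to an exchange in `ρ`, which is not blocked there unless it is blocked in `π ρ`;
therefore the convolution of invariant functions is invariant (`MoveInvariant.convolution`).

*Realization.* The group algebra embeds in the tensor algebra by `σ ↦ σ(1) ⋯ σ(n)`. If `2` is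
invertible, the peak algebra is spanned by elements attached to pseudo-compositions
`(b₀; b₁, …, b_l)`, which collect the permutations whose words consist of an increasing word of
length `b₀` and V-shaped words of lengths `b₁, …, b_l` (`peakSpace_eq_markSpace`). Right
multiplication by such an element is the convolution product of the projection to degree `b₀` and
of the operators `(rev * id) ∘ proj bᵢ`, where `rev` reverses words (`toTens_mul_markElt`).

*Eigenvalues.* A convolution of operators acts on a product of primitive elements by splitting the
factors, and Lie elements commute up to products of fewer Lie elements. Hence these operators are
triangular for the filtration of the tensor algebra by the number of Lie factors, with eigenvalues
that depend on the multiset of degrees of the factors (`Triangular.conv`). Since `rev` multiplies a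
Lie element of degree `d` by `(-1) ^ (d + 1)`, the operator `rev * id` annihilates Lie elements of
even degree and doubles those of odd degree; so the eigenvalues on multisets with sum `n` depend on
the odd degrees only (`peakCoeff_eq`), and every such multiset has the same odd members as exactly
one almost-odd partition of `n`.

*Conclusion.* For every partition of `n` there is a product of multilinear Lie elements with these
degrees which is not a combination of products of fewer Lie elements (`coeffsOp_lieList`,
`coeffsOp_val_eq_zero`), so the eigenvalue is a character of the peak algebra
(`exists_character`). An element on which the characters of the almost-odd partitions vanish lowers
the number of Lie factors, so it is nilpotent (`pow_eq_zero_of_characters_eq_zero`). These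
characters are pairwise different: the element with the even part of a partition as `b₀` and its
odd parts as `b₁, …, b_l` tells it apart from the almost-odd partitions with at most as many odd
parts (`character_separates`). By the linear independence of characters, they map the peak algebra
onto the product of copies of the field, and the kernel is the radical.
-/

namespace PeakAlgebra
open Equiv
open scoped TensorProduct

/-! ### One-line notation -/

section Words

variable {n : ℕ}

theorem word_eq (σ : Perm (Fin n)) {i : ℕ} (h1 : 1 ≤ i) (h2 : i ≤ n) :
    word σ i = (σ ⟨i - 1, by omega⟩ : ℕ) + 1 := by
  simp [word, h1, h2]

@[simp] theorem word_zero (σ : Perm (Fin n)) : word σ 0 = 0 := by simp [word]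

theorem word_fin (σ : Perm (Fin n)) (a : Fin n) : word σ (a + 1) = (σ a : ℕ) + 1 := by
  rw [word_eq σ (by omega) (by omega)]; simp

theorem word_of_gt (σ : Perm (Fin n)) {i : ℕ} (h : n < i) : word σ i = 0 := by
  simp [word]; omega

theorem one_le_word (σ : Perm (Fin n)) {i : ℕ} (h1 : 1 ≤ i) (h2 : i ≤ n) : 1 ≤ word σ i := by
  rw [word_eq σ h1 h2]; omega

theorem word_le (σ : Perm (Fin n)) (i : ℕ) : word σ i ≤ n := by
  unfold word; split_ifs <;> omega

theorem word_injective (σ : Perm (Fin n)) {a b : ℕ} (ha : 1 ≤ a) (ha' : a ≤ n) (hb : 1 ≤ b)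
    (hb' : b ≤ n) (h : word σ a = word σ b) : a = b := by
  rw [word_eq σ ha ha', word_eq σ hb hb'] at h
  have := σ.injective (Fin.ext (Nat.succ_injective h))
  rw [Fin.mk.injEq] at this
  omega

theorem word_surjective (σ : Perm (Fin n)) {v : ℕ} (h1 : 1 ≤ v) (h2 : v ≤ n) :
    ∃ j, 1 ≤ j ∧ j ≤ n ∧ word σ j = v := by
  obtain ⟨a, ha⟩ := σ.surjective ⟨v - 1, by omega⟩
  refine ⟨a + 1, by omega, by omega, ?_⟩
  rw [word_fin, ha]; simp; omega

theorem word_ext {σ τ : Perm (Fin n)} (h : ∀ j, 1 ≤ j → j ≤ n → word σ j = word τ j) :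
    σ = τ := by
  ext a
  have := h (a + 1) (by omega) (by omega)
  rw [word_fin, word_fin] at this
  omega

theorem word_mul (σ τ : Perm (Fin n)) (j : ℕ) : word (σ * τ) j = word σ (word τ j) := by
  by_cases h : 1 ≤ j ∧ j ≤ n
  · rw [word_eq (σ * τ) h.1 h.2, word_eq τ h.1 h.2, word_fin]; rfl
  · have : ∀ ρ : Perm (Fin n), word ρ j = 0 := fun ρ => by simp [word, h]
    rw [this, this, word_zero]

@[simp] theorem word_one {j : ℕ} (h : j ≤ n) : word (1 : Perm (Fin n)) j = j := by
  rcases Nat.eq_zero_or_pos j with rfl | h1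
  · simp
  · rw [word_eq _ h1 h]; simp; omega

theorem mem_peakSet {σ : Perm (Fin n)} {i : ℕ} :
    i ∈ peakSet σ ↔ 1 ≤ i ∧ i + 1 ≤ n ∧ word σ (i - 1) < word σ i ∧ word σ (i + 1) < word σ i := by
  simp only [peakSet, Finset.mem_filter, Finset.mem_Icc]
  constructor <;> rintro ⟨h1, h2⟩ <;> refine ⟨?_, ?_⟩ <;> omega

theorem peakSet_subset (σ : Perm (Fin n)) : peakSet σ ⊆ Finset.Icc 1 (n - 1) :=
  Finset.filter_subset _ _

theorem isSparse_peakSet (σ : Perm (Fin n)) : IsSparse (peakSet σ) := by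
  intro i hi hi'
  rw [mem_peakSet] at hi hi'
  simp only [Nat.add_sub_cancel] at hi'
  omega

end Words

/-! ### Exchanging two consecutive values -/

section Moves

variable {n : ℕ}

/-- The transposition of the values `i` and `i + 1` of `{1, …, n}`; the identity unless
`1 ≤ i < n`. -/
def valueSwap (n i : ℕ) : Perm (Fin n) :=
  if h : 1 ≤ i ∧ i < n then swap ⟨i - 1, by omega⟩ ⟨i, h.2⟩ else 1

theorem word_valueSwap {i : ℕ} (h1 : 1 ≤ i) (h2 : i < n) {v : ℕ} (hv : v ≤ n) :
    word (valueSwap n i) v = if v = i then i + 1 else if v = i + 1 then i else v := by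
  rcases Nat.eq_zero_or_pos v with rfl | h3
  · rw [word_zero, if_neg (by omega), if_neg (by omega)]
  · rw [word_eq _ h3 hv, valueSwap, dif_pos ⟨h1, h2⟩, swap_apply_def]
    simp only [Fin.mk.injEq]
    split_ifs <;> simp <;> omega

theorem word_valueSwap_mul {i : ℕ} (h1 : 1 ≤ i) (h2 : i < n) (σ : Perm (Fin n)) (j : ℕ) :
    word (valueSwap n i * σ) j =
      if word σ j = i then i + 1 else if word σ j = i + 1 then i else word σ j := by
  rw [word_mul, word_valueSwap h1 h2 (word_le σ j)]

theorem valueSwap_mul_self (i : ℕ) : valueSwap n i * valueSwap n i = 1 := by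
  unfold valueSwap; split_ifs <;> simp

theorem valueSwap_mul_cancel (i : ℕ) (σ : Perm (Fin n)) :
    valueSwap n i * (valueSwap n i * σ) = σ := by
  rw [← mul_assoc, valueSwap_mul_self, one_mul]

/-- The values `i` and `i + 1` of `σ` are in the adjacent positions `p` and `p + 1`. -/
def AdjacentAt (σ : Perm (Fin n)) (i p : ℕ) : Prop :=
  1 ≤ p ∧ p + 1 ≤ n ∧
    ((word σ p = i ∧ word σ (p + 1) = i + 1) ∨ (word σ p = i + 1 ∧ word σ (p + 1) = i))

/-- The exchange of the values `i` and `i + 1` of `σ` may change the peak set: the two values are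
adjacent, and are not the values `1` and `2` in positions other than the first two. -/
def Blocked (σ : Perm (Fin n)) (i : ℕ) : Prop :=
  ∃ p, AdjacentAt σ i p ∧ (2 ≤ i ∨ p = 1)

theorem AdjacentAt.valueSwap_mul {σ : Perm (Fin n)} {i p : ℕ} (h1 : 1 ≤ i) (h2 : i < n)
    (h : AdjacentAt σ i p) : valueSwap n i * σ = σ * valueSwap n p := by
  obtain ⟨hp1, hp2, h⟩ := h
  refine word_ext fun j hj1 hj2 => ?_
  rw [word_valueSwap_mul h1 h2, word_mul, word_valueSwap hp1 hp2 hj2]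
  by_cases hj : j = p
  · rw [if_pos hj, hj]
    split_ifs <;> omega
  by_cases hj' : j = p + 1
  · rw [if_neg hj, if_pos hj', hj']
    split_ifs <;> omega
  have : word σ j ≠ word σ p := fun e => hj (word_injective σ hj1 hj2 hp1 (by omega) e)
  have : word σ j ≠ word σ (p + 1) := fun e => hj' (word_injective σ hj1 hj2 (by omega) hp2 e)
  simp only [hj, hj', if_false]
  split_ifs <;> omega

theorem AdjacentAt.mul {π ρ : Perm (Fin n)} {i p q : ℕ} (h : AdjacentAt π i p)
    (h' : AdjacentAt ρ p q) : AdjacentAt (π * ρ) i q := by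
  obtain ⟨-, -, h⟩ := h
  obtain ⟨hq, hq', h'⟩ := h'
  refine ⟨hq, hq', ?_⟩
  rw [word_mul, word_mul]
  rcases h' with ⟨e, e'⟩ | ⟨e, e'⟩ <;> rw [e, e'] <;> tauto

theorem Blocked.mul {π ρ : Perm (Fin n)} {i p : ℕ} (h : AdjacentAt π i p) (h' : 2 ≤ i ∨ p = 1)
    (hρ : Blocked ρ p) : Blocked (π * ρ) i := by
  obtain ⟨q, hq, hq'⟩ := hρ
  exact ⟨q, h.mul hq, by omega⟩

theorem AdjacentAt.of_valueSwap {σ : Perm (Fin n)} {i p : ℕ} (h1 : 1 ≤ i) (h2 : i < n)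
    (h : AdjacentAt (valueSwap n i * σ) i p) : AdjacentAt σ i p := by
  obtain ⟨hp1, hp2, h⟩ := h
  refine ⟨hp1, hp2, ?_⟩
  rw [word_valueSwap_mul h1 h2, word_valueSwap_mul h1 h2] at h
  split_ifs at h <;> omega

theorem Blocked.of_valueSwap {σ : Perm (Fin n)} {i : ℕ} (h1 : 1 ≤ i) (h2 : i < n)
    (h : Blocked (valueSwap n i * σ) i) : Blocked σ i := by
  obtain ⟨p, hp, h⟩ := h
  exact ⟨p, hp.of_valueSwap h1 h2, h⟩

theorem peakSet_subset_valueSwap {σ : Perm (Fin n)} {i : ℕ} (h1 : 1 ≤ i) (h2 : i < n)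
    (h : ¬ Blocked σ i) : peakSet σ ⊆ peakSet (valueSwap n i * σ) := by
  intro j hj
  rw [mem_peakSet] at hj ⊢
  obtain ⟨hj1, hj2, hl, hr⟩ := hj
  refine ⟨hj1, hj2, ?_⟩
  have hinj : 2 ≤ j → word σ (j - 1) ≠ word σ (j + 1) := fun e e' => by
    have := word_injective σ (by omega) (by omega) (by omega) hj2 e'
    omega
  have hL : ¬ (word σ (j - 1) = i ∧ word σ j = i + 1) := by
    rintro ⟨e, e'⟩
    have hj0 : 2 ≤ j := by
      by_contra hlt
      have : j - 1 = 0 := by omega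
      rw [this, word_zero] at e; omega
    have h3 := one_le_word σ (i := j + 1) (by omega) hj2
    refine h ⟨j - 1, ⟨by omega, by omega, Or.inl ⟨e, ?_⟩⟩, Or.inl ?_⟩
    · rw [Nat.sub_add_cancel hj1]; exact e'
    · by_contra hlt
      exact hinj hj0 (by omega)
  have hR : ¬ (word σ j = i + 1 ∧ word σ (j + 1) = i) := by
    rintro ⟨e, e'⟩
    refine h ⟨j, ⟨hj1, hj2, Or.inr ⟨e, e'⟩⟩, ?_⟩
    by_contra hlt
    have h3 := one_le_word σ (i := j - 1) (by omega) (by omega)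
    exact hinj (by omega) (by omega)
  rw [word_valueSwap_mul h1 h2, word_valueSwap_mul h1 h2, word_valueSwap_mul h1 h2]
  constructor <;> split_ifs <;> omega

/-- Exchanging two consecutive values preserves the peak set unless the exchange is blocked. -/
theorem peakSet_valueSwap {σ : Perm (Fin n)} {i : ℕ} (h1 : 1 ≤ i) (h2 : i < n)
    (h : ¬ Blocked σ i) : peakSet (valueSwap n i * σ) = peakSet σ := by
  refine (peakSet_subset_valueSwap h1 h2 h).antisymm' ?_
  have := peakSet_subset_valueSwap h1 h2 (σ := valueSwap n i * σ)
    (fun h' => h (h'.of_valueSwap h1 h2))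
  rwa [valueSwap_mul_cancel] at this

/-- A function on permutations which does not change under the exchanges that are not blocked. -/
def MoveInvariant {α : Type*} (f : Perm (Fin n) → α) : Prop :=
  ∀ σ i, 1 ≤ i → i < n → ¬ Blocked σ i → f (valueSwap n i * σ) = f σ

/-- The convolution of two functions that are invariant under the exchanges that are not blocked
is invariant. An exchange on a product `π ρ` can be performed on `π`, unless it is blocked there
by two adjacent positions; then it can be performed on `ρ`, as the exchange of the two values
which are these positions. If it is blocked in `ρ` as well, then it is blocked in `π ρ`. -/
theorem MoveInvariant.convolution {R : Type*} [CommSemiring R] {x y : Perm (Fin n) → R}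
    (hx : MoveInvariant x) (hy : MoveInvariant y) :
    MoveInvariant fun σ => ∑ π, x π * y (π⁻¹ * σ) := by
  classical
  intro σ i h1 h2 hσ
  let e : Perm (Fin n) → Perm (Fin n) := fun π =>
    if Blocked π i then π else valueSwap n i * π
  have he : Function.Involutive e := by
    intro π
    by_cases hπ : Blocked π i
    · simp [e, hπ]
    · have : ¬ Blocked (valueSwap n i * π) i := fun h' => hπ (h'.of_valueSwap h1 h2)
      simp [e, hπ, this, valueSwap_mul_cancel]
  refine Fintype.sum_bijective e he.bijective _ _ fun π => ?_
  by_cases hπ : Blocked π i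
  · simp only [e, hπ, if_true]
    obtain ⟨p, hp, hp'⟩ := hπ
    have hρ : ¬ Blocked (π⁻¹ * σ) p := fun hb => hσ (by simpa using hb.mul hp hp')
    have : π⁻¹ * (valueSwap n i * σ) = valueSwap n p * (π⁻¹ * σ) := by
      have := hp.valueSwap_mul h1 h2
      rw [inv_mul_eq_iff_eq_mul, ← mul_assoc, ← mul_assoc, ← this, mul_assoc, mul_assoc,
        mul_inv_cancel_left]
    rw [this, hy _ p hp.1 (by have := hp.2.1; omega) hρ]
  · simp only [e, hπ, if_false]
    rw [hx π i h1 h2 hπ, mul_inv_rev, mul_assoc]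
    rw [inv_mul_eq_iff_eq_mul.2 (valueSwap_mul_cancel i σ).symm]

end Moves

/-! ### Permutations with the same peak set -/

section Connectivity

variable {n : ℕ}

/-- The descent set of a permutation of `[n]`. -/
def desSet (σ : Perm (Fin n)) : Finset ℕ :=
  (Finset.Icc 1 (n - 1)).filter fun i => word σ (i + 1) < word σ i

theorem mem_desSet {σ : Perm (Fin n)} {i : ℕ} :
    i ∈ desSet σ ↔ 1 ≤ i ∧ i + 1 ≤ n ∧ word σ (i + 1) < word σ i := by
  simp only [desSet, Finset.mem_filter, Finset.mem_Icc]
  constructor <;> rintro ⟨h1, h2⟩ <;> refine ⟨?_, ?_⟩ <;> omega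

theorem word_lt_of_notMem_desSet {σ : Perm (Fin n)} {i : ℕ} (h1 : 1 ≤ i) (h2 : i + 1 ≤ n)
    (h : i ∉ desSet σ) : word σ i < word σ (i + 1) := by
  have h3 : ¬ word σ (i + 1) < word σ i := fun h3 => h (mem_desSet.2 ⟨h1, h2, h3⟩)
  have h4 : word σ i ≠ word σ (i + 1) := fun e => by
    have := word_injective σ h1 (by omega) (by omega) h2 e
    omega
  omega

theorem not_blocked_of_not_adjacentAt {σ : Perm (Fin n)} {i : ℕ}
    (h : ∀ p, ¬ AdjacentAt σ i p) : ¬ Blocked σ i := fun ⟨p, hp, _⟩ => h p hp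

theorem desSet_valueSwap {σ : Perm (Fin n)} {i : ℕ} (h1 : 1 ≤ i) (h2 : i < n)
    (h : ∀ p, ¬ AdjacentAt σ i p) : desSet (valueSwap n i * σ) = desSet σ := by
  ext p
  rw [mem_desSet, mem_desSet, word_valueSwap_mul h1 h2, word_valueSwap_mul h1 h2]
  refine and_congr_right fun hp1 => and_congr_right fun hp2 => ?_
  have h3 : ¬ _ := fun h3 => h p ⟨hp1, hp2, h3⟩
  split_ifs <;> omega

variable {α : Type*} {f : Perm (Fin n) → α}

/-- The value in a position `p` which is not the start of a descent, and is the end of one unless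
`p = 1`, can be lowered to `1` one step at a time: the next lower value is never adjacent to it,
and so the exchanges do not change the descents. -/
theorem exists_word_valley_eq_one (hf : MoveInvariant f) {p : ℕ} (hp1 : 1 ≤ p) (hp2 : p ≤ n) :
    ∀ (v : ℕ) (σ : Perm (Fin n)), word σ p = v → (2 ≤ p → p - 1 ∈ desSet σ) → p ∉ desSet σ →
      ∃ τ, f τ = f σ ∧ desSet τ = desSet σ ∧ word τ p = 1 := by
  intro v
  induction v with
  | zero =>
    intro σ h
    have := one_le_word σ hp1 hp2
    omega
  | succ v ih =>
    intro σ hv hl hr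
    rcases Nat.eq_zero_or_pos v with rfl | hv0
    · exact ⟨σ, rfl, rfl, hv⟩
    have hvn : v < n := by have := word_le σ p; omega
    have hadj : ∀ q, ¬ AdjacentAt σ v q := by
      rintro q ⟨hq1, hq2, ⟨e, e'⟩ | ⟨e, e'⟩⟩
      · have := word_injective σ hp1 hp2 (by omega) hq2 (hv.trans e'.symm)
        subst this
        have := (mem_desSet.1 (hl (by omega))).2.2
        simp only [Nat.add_sub_cancel] at this
        omega
      · have := word_injective σ hp1 hp2 (by omega) (by omega) (hv.trans e.symm)
        subst this
        have := word_lt_of_notMem_desSet hq1 hq2 hr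
        omega
    have hd := desSet_valueSwap hv0 hvn hadj
    obtain ⟨τ, h1, h2, h3⟩ := ih (valueSwap n v * σ)
      (by rw [word_valueSwap_mul hv0 hvn, hv]; simp) (by rwa [hd]) (by rwa [hd])
    exact ⟨τ, h1.trans (hf σ v hv0 hvn (not_blocked_of_not_adjacentAt hadj)), h2.trans hd, h3⟩

/-- When the value `1` is in position `q + 1` and a descent starts in position `q - 1`, the value
in position `q` can be lowered to `2` by exchanges of non-adjacent values. -/
theorem exists_word_before_valley_eq_two (hf : MoveInvariant f) {q : ℕ} (hq1 : 2 ≤ q)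
    (hq2 : q + 1 ≤ n) :
    ∀ (v : ℕ) (σ : Perm (Fin n)), word σ q = v → word σ (q + 1) = 1 → q - 1 ∈ desSet σ →
      ∃ τ, f τ = f σ ∧ desSet τ = desSet σ ∧ word τ (q + 1) = 1 ∧ word τ q = 2 := by
  intro v
  induction v with
  | zero =>
    intro σ h
    have := one_le_word σ (i := q) (by omega) (by omega)
    omega
  | succ v ih =>
    intro σ hv h1 hl
    have hv0 : 1 ≤ v := by
      by_contra hlt
      have := word_injective σ (a := q) (b := q + 1) (by omega) (by omega) (by omega) hq2
        (by omega)
      omega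
    rcases eq_or_lt_of_le hv0 with rfl | hv1
    · exact ⟨σ, rfl, rfl, h1, hv⟩
    have hvn : v < n := by have := word_le σ q; omega
    have hadj : ∀ p, ¬ AdjacentAt σ v p := by
      rintro p ⟨hp1, hp2, ⟨e, e'⟩ | ⟨e, e'⟩⟩
      · have := word_injective σ (by omega) (by omega) (by omega) hp2 (hv.trans e'.symm)
        subst this
        have := (mem_desSet.1 hl).2.2
        simp only [Nat.add_sub_cancel] at this
        omega
      · have := word_injective σ (by omega) (by omega) (by omega) (by omega) (hv.trans e.symm)
        subst this
        omega
    have hd := desSet_valueSwap hv0 hvn hadj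
    obtain ⟨τ, h1, h2, h3⟩ := ih (valueSwap n v * σ)
      (by rw [word_valueSwap_mul hv0 hvn, hv]; simp)
      (by rw [word_valueSwap_mul hv0 hvn, h1]; split_ifs <;> omega) (by rwa [hd])
    exact ⟨τ, h1.trans (hf σ v hv0 hvn (not_blocked_of_not_adjacentAt hadj)), h2.trans hd, h3⟩

/-- Two consecutive descents can be removed: at the end of a maximal decreasing run, the last two
values can be lowered to `2` and `1`, which can then be exchanged. -/
theorem exists_card_desSet_lt (hf : MoveInvariant f) (σ : Perm (Fin n))
    (h : ∃ p ∈ desSet σ, p + 1 ∈ desSet σ) :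
    ∃ τ, f τ = f σ ∧ (desSet τ).card < (desSet σ).card := by
  classical
  obtain ⟨p, hp, hmax⟩ := Finset.exists_max_image ((desSet σ).filter (· + 1 ∈ desSet σ)) id
    (by obtain ⟨p, hp, hp'⟩ := h; exact ⟨p, Finset.mem_filter.2 ⟨hp, hp'⟩⟩)
  obtain ⟨hp, hp'⟩ := Finset.mem_filter.1 hp
  have hp'' : p + 2 ∉ desSet σ := fun h => by
    have := hmax (p + 1) (Finset.mem_filter.2 ⟨hp', h⟩)
    simp at this
  have hp1 := (mem_desSet.1 hp).1
  have hp2 := (mem_desSet.1 hp').2.1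
  obtain ⟨σ₁, hf1, hd1, hw1⟩ := exists_word_valley_eq_one hf (p := p + 2) (by omega) hp2 _ σ rfl
    (fun _ => hp') hp''
  obtain ⟨τ, hf2, hd2, hw2, hw3⟩ := exists_word_before_valley_eq_two hf (q := p + 1) (by omega)
    hp2 _ σ₁ rfl hw1 (by rw [hd1]; exact hp)
  have h1n : 1 < n := by omega
  have hpos : ∀ j, 1 ≤ j → j ≤ n → word τ j = 2 → j = p + 1 := fun j h1 h2 e =>
    word_injective τ h1 h2 (by omega) (by omega) (e.trans hw3.symm)
  have hpos' : ∀ j, 1 ≤ j → j ≤ n → word τ j = 1 → j = p + 2 := fun j h1 h2 e =>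
    word_injective τ h1 h2 (by omega) (by omega) (e.trans hw2.symm)
  have hb : ¬ Blocked τ 1 := by
    rintro ⟨q, ⟨hq1, hq2, ⟨e, e'⟩ | ⟨e, e'⟩⟩, h⟩
    · have := hpos' q hq1 (by omega) e
      have := hpos (q + 1) (by omega) hq2 e'
      omega
    · have := hpos q hq1 (by omega) e
      omega
  refine ⟨valueSwap n 1 * τ, (hf τ 1 le_rfl h1n hb).trans (hf2.trans hf1), ?_⟩
  rw [← hd1, ← hd2]
  refine Finset.card_lt_card (Finset.ssubset_iff_of_subset ?_ |>.2 ⟨p + 1, ?_, ?_⟩)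
  · intro j hj
    rw [mem_desSet, word_valueSwap_mul le_rfl h1n, word_valueSwap_mul le_rfl h1n] at hj
    obtain ⟨hj1, hj2, hj⟩ := hj
    refine mem_desSet.2 ⟨hj1, hj2, ?_⟩
    have := hpos j hj1 (by omega)
    have := hpos' j hj1 (by omega)
    have := hpos (j + 1) (by omega) hj2
    have := hpos' (j + 1) (by omega) hj2
    have := one_le_word τ (i := j) (by omega) (by omega)
    have := one_le_word τ (i := j + 1) (by omega) (by omega)
    split_ifs at hj <;> omega
  · rw [hd2, hd1]; exact hp'
  · intro hj
    have := (mem_desSet.1 hj).2.2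
    rw [word_valueSwap_mul le_rfl h1n, word_valueSwap_mul le_rfl h1n, hw2, hw3] at this
    simp at this

/-- A permutation is layered if its word is a concatenation of decreasing runs of consecutive
values, with increasing values from run to run: if `v + 1` precedes `v`, then they are adjacent. -/
def Layered (σ : Perm (Fin n)) : Prop :=
  ∀ a b, 1 ≤ a → a < b → b ≤ n → word σ a = word σ b + 1 → b = a + 1

/-- The lexicographically least permutation with the descents of `σ` and the value `f σ` is
layered: otherwise some exchange of non-adjacent values makes it smaller. -/
theorem exists_layered (hf : MoveInvariant f) (σ : Perm (Fin n)) :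
    ∃ τ, f τ = f σ ∧ desSet τ = desSet σ ∧ Layered τ := by
  classical
  obtain ⟨τ, hτ, hmin⟩ := Finset.exists_min_image
    (Finset.univ.filter fun τ : Perm (Fin n) => f τ = f σ ∧ desSet τ = desSet σ)
    (fun τ => toLex fun a : Fin n => word τ (a + 1)) ⟨σ, by simp⟩
  obtain ⟨hfτ, hdτ⟩ := (Finset.mem_filter.1 hτ).2
  refine ⟨τ, hfτ, hdτ, ?_⟩
  intro a b ha hab hb hw
  by_contra hne
  have h1 : 1 ≤ word τ b := one_le_word τ (by omega) hb
  have h2 : word τ b < n := by have := word_le τ a; omega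
  have hadj : ∀ p, ¬ AdjacentAt τ (word τ b) p := by
    rintro p ⟨hp1, hp2, ⟨e, e'⟩ | ⟨e, e'⟩⟩
    · have := word_injective τ hp1 (by omega) (by omega) hb e
      have := word_injective τ (by omega) hp2 ha (by omega) (e'.trans hw.symm)
      omega
    · have := word_injective τ (by omega) (by omega) (by omega) hb e'
      have := word_injective τ hp1 (by omega) ha (by omega) (e.trans hw.symm)
      omega
  have hlt := hmin (valueSwap n (word τ b) * τ) (Finset.mem_filter.2 ⟨Finset.mem_univ _,
    (hf τ _ h1 h2 (not_blocked_of_not_adjacentAt hadj)).trans hfτ,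
    (desSet_valueSwap h1 h2 hadj).trans hdτ⟩)
  refine absurd hlt (not_le.2 ⟨⟨a - 1, by omega⟩, ?_, ?_⟩)
  · intro c hc
    have hc' : (c : ℕ) + 1 < a := by
      have : (c : ℕ) < a - 1 := hc
      omega
    have h3 : word τ (c + 1) ≠ word τ a := fun e => by
      have := word_injective τ (by omega) (by omega) ha (by omega) e
      omega
    have h4 : word τ (c + 1) ≠ word τ b := fun e => by
      have := word_injective τ (by omega) (by omega) (by omega) hb e
      omega
    change word _ _ = word _ _
    rw [word_valueSwap_mul h1 h2]
    split_ifs <;> omega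
  · change word _ (a - 1 + 1) < word _ (a - 1 + 1)
    rw [word_valueSwap_mul h1 h2, Nat.sub_add_cancel ha, hw]
    split_ifs <;> omega

theorem Layered.word_eq_word_succ_add_one {σ : Perm (Fin n)} (h : Layered σ) {a b : ℕ}
    (ha : 1 ≤ a) (hab : a < b) (hb : b ≤ n) (hw : word σ b < word σ a) :
    word σ a = word σ (a + 1) + 1 := by
  classical
  -- The least value above `word σ b` which is in one of the positions up to `a`.
  have hex : ∃ v, word σ b < v ∧ ∃ d, 1 ≤ d ∧ d ≤ a ∧ word σ d = v :=
    ⟨word σ a, hw, a, ha, le_rfl, rfl⟩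
  obtain ⟨hv, d, hd1, hd2, hd⟩ := Nat.find_spec hex
  have hmin := fun m hm => Nat.find_min hex (m := m) hm
  set v := Nat.find hex
  have hvb := one_le_word σ (i := b) (by omega) hb
  obtain ⟨c, hc1, hc2, hc⟩ := word_surjective σ (v := v - 1) (by omega)
    (by have := word_le σ d; omega)
  have hca : a < c := by
    by_contra hle
    have h1 := hmin (v - 1) (by omega)
    have h2 : ¬ word σ b < v - 1 := fun h2 => h1 ⟨h2, c, hc1, by omega, hc⟩
    have := word_injective σ hc1 hc2 (by omega) hb (by omega)
    omega
  have hcd := h d c hd1 (by omega) hc2 (by omega)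
  have : d = a := by omega
  subst this
  rw [← hcd]
  omega

/-- The inversions of a layered permutation are the pairs of positions in a common decreasing
run, so they are determined by the descents. -/
theorem Layered.word_lt_iff {σ : Perm (Fin n)} (h : Layered σ) {a b : ℕ}
    (ha : 1 ≤ a) (hab : a < b) (hb : b ≤ n) :
    word σ b < word σ a ↔ ∀ c, a ≤ c → c < b → c ∈ desSet σ := by
  constructor
  · intro hw
    obtain ⟨k, rfl⟩ := Nat.exists_eq_add_of_lt hab
    induction k generalizing a with
    | zero =>
      intro c hc1 hc2
      obtain rfl : c = a := by omega
      exact mem_desSet.2 ⟨ha, hb, hw⟩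
    | succ k ih =>
      intro c hc1 hc2
      have h1 := h.word_eq_word_succ_add_one ha hab hb hw
      rcases eq_or_lt_of_le hc1 with rfl | hc1
      · exact mem_desSet.2 ⟨ha, by omega, by omega⟩
      · have h2 : word σ (a + 1) ≠ word σ (a + (k + 1) + 1) := fun e => by
          have := word_injective σ (by omega) (by omega) (by omega) hb e
          omega
        have e : a + 1 + k + 1 = a + (k + 1) + 1 := by omega
        refine ih (a := a + 1) (by omega) (by omega) (by omega) ?_ c hc1 (by omega)
        rw [e]
        omega
  · intro hc
    obtain ⟨k, rfl⟩ := Nat.exists_eq_add_of_lt hab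
    induction k with
    | zero => exact (mem_desSet.1 (hc a le_rfl (by omega))).2.2
    | succ k ih =>
      have h1 := ih (by omega) (by omega) fun c h1 h2 => hc c h1 (by omega)
      have h2 := (mem_desSet.1 (hc (a + k + 1) (by omega) (by omega))).2.2
      exact h2.trans h1

theorem Layered.eq_of_desSet_eq {σ τ : Perm (Fin n)} (hσ : Layered σ) (hτ : Layered τ)
    (h : desSet σ = desSet τ) : σ = τ := by
  have key : ∀ a b : Fin n, a < b → (σ b < σ a ↔ τ b < τ a) := fun a b hab => by
    have h1 := hσ.word_lt_iff (a := a + 1) (b := b + 1) (by omega) (by simpa using hab) (by omega)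
    have h2 := hτ.word_lt_iff (a := a + 1) (b := b + 1) (by omega) (by simpa using hab) (by omega)
    rw [h, ← h2] at h1
    simpa [word_fin] using h1
  have hmono : StrictMono (τ * σ⁻¹) := by
    intro x y hxy
    rcases lt_trichotomy (σ⁻¹ x) (σ⁻¹ y) with hlt | heq | hlt
    · have := key _ _ hlt
      rw [← Perm.mul_apply, ← Perm.mul_apply, mul_inv_cancel] at this
      simp only [Perm.one_apply, not_lt_of_gt hxy, false_iff, not_lt] at this
      exact lt_of_le_of_ne this fun e => hlt.ne (τ.injective e)
    · exact absurd (σ⁻¹.injective heq) hxy.ne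
    · have := key _ _ hlt
      rw [← Perm.mul_apply, ← Perm.mul_apply, mul_inv_cancel] at this
      exact this.1 hxy
  have : ⇑(τ * σ⁻¹) = id := (hmono.range_inj strictMono_id).1 (by
    rw [Set.range_id, (τ * σ⁻¹).surjective.range_eq])
  have h1 : τ * σ⁻¹ = 1 := by ext x; simp [this]
  exact (mul_inv_eq_one.1 h1).symm

/-- Every value of `f` is attained at a layered permutation all of whose descents are peaks. -/
theorem exists_canonical (hf : MoveInvariant f) (σ : Perm (Fin n)) :
    ∃ τ, f τ = f σ ∧ desSet τ = peakSet τ ∧ Layered τ := by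
  induction hk : (desSet σ).card using Nat.strong_induction_on generalizing σ with
  | _ k ih =>
    by_cases h : ∃ p ∈ desSet σ, p + 1 ∈ desSet σ
    · obtain ⟨τ, h1, h2⟩ := exists_card_desSet_lt hf σ h
      obtain ⟨τ', h3, h4⟩ := ih _ (hk ▸ h2) τ rfl
      exact ⟨τ', h3.trans h1, h4⟩
    · obtain ⟨τ, h1, h2, h3⟩ := exists_layered hf σ
      refine ⟨τ, h1, ?_, h3⟩
      ext p
      rw [mem_peakSet]
      constructor
      · intro hp
        obtain ⟨hp1, hp2, hp3⟩ := mem_desSet.1 hp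
        refine ⟨hp1, hp2, ?_, hp3⟩
        rcases eq_or_lt_of_le hp1 with rfl | hp1
        · simpa [Nat.pos_iff_ne_zero, Nat.one_le_iff_ne_zero] using one_le_word τ le_rfl (by omega)
        · have h4 : p - 1 ∉ desSet τ := fun h4 => h ⟨p - 1, h2 ▸ h4, by
            rw [Nat.sub_add_cancel (by omega), ← h2]; exact hp⟩
          have := word_lt_of_notMem_desSet (by omega) (by omega) h4
          rwa [Nat.sub_add_cancel (by omega)] at this
      · rintro ⟨hp1, hp2, -, hp3⟩
        exact mem_desSet.2 ⟨hp1, hp2, hp3⟩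

/-- A function invariant under the exchanges that are not blocked depends on the peak set only:
these exchanges connect any two permutations with the same peak set. -/
theorem MoveInvariant.eq_of_peakSet_eq (hf : MoveInvariant f) {σ τ : Perm (Fin n)}
    (h : peakSet σ = peakSet τ) : f σ = f τ := by
  have hf' : MoveInvariant fun σ => (f σ, peakSet σ) := fun σ i h1 h2 hb => by
    simp only [hf σ i h1 h2 hb, peakSet_valueSwap h1 h2 hb]
  obtain ⟨σ', h1, h2, h3⟩ := exists_canonical hf' σ
  obtain ⟨τ', h4, h5, h6⟩ := exists_canonical hf' τ
  rw [Prod.mk.injEq] at h1 h4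
  have : σ' = τ' := h3.eq_of_desSet_eq h6 (by rw [h2, h5, h1.2, h4.2, h])
  rw [← h1.1, ← h4.1, this]

end Connectivity

/-! ### The peak algebra -/

section Algebra

variable (𝕜 : Type*) [Field 𝕜] {n : ℕ}

theorem coeff_peakSum (F : Finset ℕ) (σ : Perm (Fin n)) :
    (peakSum 𝕜 n F).coeff σ = if peakSet σ = F then 1 else 0 := by
  classical
  rw [peakSum, MonoidAlgebra.coeff_sum, Finsupp.finsetSum_apply]
  simp [Finsupp.single_apply, Finset.mem_filter]

/-- The span of the elements `P_F` consists of the functions of the peak set. The sets `F` in its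
definition which are not peak sets contribute nothing, as then `P_F = 0`. -/
theorem mem_peakSpace_iff {x : MonoidAlgebra 𝕜 (Perm (Fin n))} :
    x ∈ peakSpace 𝕜 n ↔ ∀ σ τ, peakSet σ = peakSet τ → x.coeff σ = x.coeff τ := by
  classical
  constructor
  · intro hx σ τ h
    induction hx using Submodule.span_induction with
    | mem x hx =>
      obtain ⟨F, -, -, rfl⟩ := hx
      rw [coeff_peakSum, coeff_peakSum, h]
    | zero => simp
    | add x y _ _ hx hy => simp [hx, hy]
    | smul a x _ hx => simp [hx]
  · intro hx
    have hx' : x = ∑ F ∈ Finset.univ.image (peakSet (n := n)),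
        (if h : ∃ σ, peakSet σ = F then x.coeff h.choose else 0) • peakSum 𝕜 n F := by
      ext σ
      rw [MonoidAlgebra.coeff_sum, Finsupp.finsetSum_apply, Finset.sum_eq_single (peakSet σ)]
      · have h : ∃ τ : Perm (Fin n), peakSet τ = peakSet σ := ⟨σ, rfl⟩
        rw [dif_pos h, MonoidAlgebra.coeff_smul, Finsupp.smul_apply, coeff_peakSum, if_pos rfl,
          hx _ _ h.choose_spec]
        simp
      · intro F _ hF
        rw [MonoidAlgebra.coeff_smul, Finsupp.smul_apply, coeff_peakSum, if_neg hF.symm, smul_zero]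
      · intro h
        exact absurd (Finset.mem_image_of_mem _ (Finset.mem_univ σ)) h
    rw [hx']
    refine Submodule.sum_mem _ fun F hF => Submodule.smul_mem _ _ (Submodule.subset_span ?_)
    obtain ⟨σ, -, rfl⟩ := Finset.mem_image.1 hF
    exact ⟨_, peakSet_subset σ, isSparse_peakSet σ, rfl⟩

theorem mem_peakSpace_iff_moveInvariant {x : MonoidAlgebra 𝕜 (Perm (Fin n))} :
    x ∈ peakSpace 𝕜 n ↔ MoveInvariant x.coeff := by
  rw [mem_peakSpace_iff]
  exact ⟨fun h σ i h1 h2 hb => h _ _ (peakSet_valueSwap h1 h2 hb),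
    fun h σ τ hστ => h.eq_of_peakSet_eq hστ⟩

theorem coeff_mul_perm (x y : MonoidAlgebra 𝕜 (Perm (Fin n))) (σ : Perm (Fin n)) :
    (x * y).coeff σ = ∑ π, x.coeff π * y.coeff (π⁻¹ * σ) := by
  rw [MonoidAlgebra.coeff_mul_antidiag x y σ
    (Finset.univ.image fun π : Perm (Fin n) => (π, π⁻¹ * σ)), Finset.sum_image]
  · exact fun _ _ _ _ h => (Prod.mk.inj h).1
  · rintro ⟨π, ρ⟩
    simp only [Finset.mem_image, Finset.mem_univ, Prod.mk.injEq, true_and, exists_eq_left,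
      inv_mul_eq_iff_eq_mul]
    exact eq_comm

theorem mul_mem_peakSpace {x y : MonoidAlgebra 𝕜 (Perm (Fin n))} (hx : x ∈ peakSpace 𝕜 n)
    (hy : y ∈ peakSpace 𝕜 n) : x * y ∈ peakSpace 𝕜 n := by
  rw [mem_peakSpace_iff_moveInvariant] at *
  have := hx.convolution hy
  intro σ i h1 h2 hb
  rw [coeff_mul_perm, coeff_mul_perm]
  exact this σ i h1 h2 hb

/-- Only the identity has no peaks, since the word of a permutation starts with an ascent from
`σ(0) = 0`. -/
theorem eq_one_of_peakSet_eq {σ : Perm (Fin n)} (h : peakSet σ = ∅) : σ = 1 := by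
  have key : ∀ j, j + 1 ≤ n → word σ j < word σ (j + 1) := by
    intro j
    induction j with
    | zero =>
      intro hj
      simpa [Nat.pos_iff_ne_zero, Nat.one_le_iff_ne_zero] using one_le_word σ le_rfl hj
    | succ j ih =>
      intro hj
      have h1 := ih (by omega)
      have h2 : j + 1 ∉ peakSet σ := by simp [h]
      rw [mem_peakSet] at h2
      have h3 : word σ (j + 1) ≠ word σ (j + 1 + 1) := fun e => by
        have := word_injective σ (by omega) (by omega) (by omega) hj e
        omega
      simp only [Nat.add_sub_cancel] at h2
      omega
  have hge : ∀ j, j ≤ n → j ≤ word σ j := by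
    intro j
    induction j with
    | zero => simp
    | succ j ih => intro hj; have := ih (by omega); have := key j hj; omega
  have hle : ∀ k j, j + k = n → word σ j ≤ j := by
    intro k
    induction k with
    | zero => intro j hj; have := word_le σ j; omega
    | succ k ih =>
      intro j hj
      have := ih (j + 1) (by omega)
      have := key j (by omega)
      omega
  refine word_ext fun j _ hj => ?_
  rw [word_one hj]
  exact (hle (n - j) j (by omega)).antisymm (hge j hj)

theorem one_mem_peakSpace : (1 : MonoidAlgebra 𝕜 (Perm (Fin n))) ∈ peakSpace 𝕜 n := by
  classical
  have h0 : peakSet (1 : Perm (Fin n)) = ∅ := by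
    ext i
    rw [mem_peakSet]
    simp only [Finset.notMem_empty, iff_false]
    rintro ⟨h1, h2, h3, h4⟩
    rw [word_one (by omega), word_one (by omega)] at h4
    omega
  rw [mem_peakSpace_iff]
  intro σ τ h
  by_cases hσ : σ = 1
  · subst hσ
    rw [eq_one_of_peakSet_eq (h.symm.trans h0)]
  · have hτ : τ ≠ 1 := by
      rintro rfl
      exact hσ (eq_one_of_peakSet_eq (h.trans h0))
    rw [MonoidAlgebra.one_def, MonoidAlgebra.coeff_single, Finsupp.single_eq_of_ne hσ,
      Finsupp.single_eq_of_ne hτ]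

/-- The linear span of the elements `P_F` is a unital subalgebra. -/
theorem peakAlgebra_toSubmodule :
    Subalgebra.toSubmodule (peakAlgebra 𝕜 n) = peakSpace 𝕜 n := by
  let S : Subalgebra 𝕜 (MonoidAlgebra 𝕜 (Perm (Fin n))) :=
    (peakSpace 𝕜 n).toSubalgebra (one_mem_peakSpace 𝕜) fun _ _ => mul_mem_peakSpace 𝕜
  have : peakAlgebra 𝕜 n = S :=
    le_antisymm (Algebra.adjoin_le fun x hx => hx) fun x hx => Algebra.subset_adjoin hx
  rw [this]
  ext x
  rfl

theorem mem_peakAlgebra {x : MonoidAlgebra 𝕜 (Perm (Fin n))} :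
    x ∈ peakAlgebra 𝕜 n ↔ x ∈ peakSpace 𝕜 n := by
  rw [← peakAlgebra_toSubmodule, Subalgebra.mem_toSubmodule]

end Algebra

/-! ### The tensor algebra, its coproduct and convolution -/

noncomputable section Tensor

/-- The tensor algebra on the letters `X`, realized as the algebra of the free monoid. -/
abbrev Tens (𝕜 X : Type*) [Field 𝕜] := MonoidAlgebra 𝕜 (FreeMonoid X)

variable (𝕜 : Type*) [Field 𝕜] {X Y : Type*}

/-- A word, as an element of the tensor algebra. -/
def wordOf (w : List X) : Tens 𝕜 X := MonoidAlgebra.single (FreeMonoid.ofList w) 1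

theorem wordOf_nil : wordOf 𝕜 ([] : List X) = 1 := rfl

theorem wordOf_append (u v : List X) : wordOf 𝕜 (u ++ v) = wordOf 𝕜 u * wordOf 𝕜 v := by
  simp [wordOf, MonoidAlgebra.single_mul_single]

theorem wordOf_cons (x : X) (v : List X) : wordOf 𝕜 (x :: v) = wordOf 𝕜 [x] * wordOf 𝕜 v :=
  wordOf_append 𝕜 [x] v

theorem coeff_wordOf [DecidableEq X] (w z : List X) :
    (wordOf 𝕜 w).coeff (FreeMonoid.ofList z) = if z = w then 1 else 0 := by
  classical
  simp [wordOf, MonoidAlgebra.coeff_single, Finsupp.single_apply, eq_comm]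

/-- The algebra map from the tensor algebra which extends a map on letters. -/
def tensLift {A : Type*} [Semiring A] [Algebra 𝕜 A] (f : X → A) : Tens 𝕜 X →ₐ[𝕜] A :=
  MonoidAlgebra.lift 𝕜 A (FreeMonoid X) (FreeMonoid.lift f)

theorem tensLift_letter {A : Type*} [Semiring A] [Algebra 𝕜 A] (f : X → A) (x : X) :
    tensLift 𝕜 f (wordOf 𝕜 [x]) = f x := by
  simp [tensLift, wordOf]

/-- The unshuffle coproduct, for which the letters are primitive. -/
def comul : Tens 𝕜 X →ₐ[𝕜] Tens 𝕜 X ⊗[𝕜] Tens 𝕜 X :=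
  tensLift 𝕜 fun x => wordOf 𝕜 [x] ⊗ₜ 1 + 1 ⊗ₜ wordOf 𝕜 [x]

/-- Reversal of words, as an algebra map to the opposite algebra. -/
def revAlg : Tens 𝕜 X →ₐ[𝕜] (Tens 𝕜 X)ᵐᵒᵖ :=
  tensLift 𝕜 fun x => MulOpposite.op (wordOf 𝕜 [x])

/-- Reversal of words. -/
def rev : Tens 𝕜 X →ₗ[𝕜] Tens 𝕜 X :=
  (MulOpposite.opLinearEquiv 𝕜).symm.toLinearMap ∘ₗ (revAlg 𝕜).toLinearMap

theorem rev_mul (a b : Tens 𝕜 X) : rev 𝕜 (a * b) = rev 𝕜 b * rev 𝕜 a := by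
  simp [rev]

theorem rev_one : rev 𝕜 (1 : Tens 𝕜 X) = 1 := by simp [rev]

theorem rev_letter (x : X) : rev 𝕜 (wordOf 𝕜 [x]) = wordOf 𝕜 [x] := by
  simp [rev, revAlg, tensLift_letter]

/-- The algebra map which multiplies a word of length `d` by the `d`-th power of a variable. -/
def grade : Tens 𝕜 X →ₐ[𝕜] Polynomial (Tens 𝕜 X) :=
  tensLift 𝕜 fun x => Polynomial.monomial 1 (wordOf 𝕜 [x])

/-- The projection to the homogeneous component of degree `d`. -/
def proj (d : ℕ) : Tens 𝕜 X →ₗ[𝕜] Tens 𝕜 X :=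
  (Polynomial.lcoeff (Tens 𝕜 X) d).restrictScalars 𝕜 ∘ₗ (grade 𝕜).toLinearMap

theorem proj_apply (d : ℕ) (t : Tens 𝕜 X) : proj 𝕜 d t = (grade 𝕜 t).coeff d := rfl

variable {𝕜}

/-- The convolution of two linear endomorphisms of the tensor algebra. -/
def conv (f g : Tens 𝕜 X →ₗ[𝕜] Tens 𝕜 X) : Tens 𝕜 X →ₗ[𝕜] Tens 𝕜 X :=
  LinearMap.mul' 𝕜 (Tens 𝕜 X) ∘ₗ TensorProduct.map f g ∘ₗ (comul 𝕜).toLinearMap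

/-! ### Lie elements -/

/-- The properties of a homogeneous Lie polynomial `L` of degree `d ≥ 1` which are used: it is
primitive, it is homogeneous, and the reversal acts on it by the sign `(-1) ^ (d - 1)`. -/
structure IsLie (d : ℕ) (L : Tens 𝕜 X) : Prop where
  pos : 1 ≤ d
  primitive : comul 𝕜 L = L ⊗ₜ 1 + 1 ⊗ₜ L
  homogeneous : grade 𝕜 L = Polynomial.monomial d L
  reversal : rev 𝕜 L = (-1 : 𝕜) ^ (d + 1) • L

theorem isLie_letter (x : X) : IsLie 1 (wordOf 𝕜 [x]) where
  pos := le_rfl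
  primitive := tensLift_letter _ _ _
  homogeneous := tensLift_letter _ _ _
  reversal := by simp [rev_letter]

theorem IsLie.bracket {d e : ℕ} {L M : Tens 𝕜 X} (hL : IsLie d L) (hM : IsLie e M) :
    IsLie (d + e) (L * M - M * L) where
  pos := by have := hL.pos; omega
  primitive := by
    rw [map_sub, map_mul, map_mul, hL.primitive, hM.primitive]
    simp only [add_mul, mul_add, Algebra.TensorProduct.tmul_mul_tmul, one_mul, mul_one,
      TensorProduct.sub_tmul, TensorProduct.tmul_sub]
    abel
  homogeneous := by
    rw [map_sub, map_mul, map_mul, hL.homogeneous, hM.homogeneous,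
      Polynomial.monomial_mul_monomial, Polynomial.monomial_mul_monomial, add_comm e d, ← map_sub]
  reversal := by
    rw [map_sub, rev_mul, rev_mul, hL.reversal, hM.reversal, smul_mul_smul_comm,
      smul_mul_smul_comm, mul_comm ((-1 : 𝕜) ^ (e + 1)), ← smul_sub, ← neg_sub (L * M), smul_neg,
      ← neg_smul]
    congr 1
    ring

/-- The list `ℓ` consists of pairs `(d, L)` of a degree and a Lie element of this degree. -/
def IsLieList (ℓ : List (ℕ × Tens 𝕜 X)) : Prop := ∀ p ∈ ℓ, IsLie p.1 p.2

/-- The product of the elements in a list of pairs of a degree and an element. -/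
def val (ℓ : List (ℕ × Tens 𝕜 X)) : Tens 𝕜 X := (ℓ.map Prod.snd).prod

/-- The multiset of degrees in a list of pairs of a degree and an element. -/
def degs (ℓ : List (ℕ × Tens 𝕜 X)) : Multiset ℕ := (ℓ.map Prod.fst : List ℕ)

@[simp] theorem val_nil : val ([] : List (ℕ × Tens 𝕜 X)) = 1 := rfl

@[simp] theorem val_cons (p : ℕ × Tens 𝕜 X) (ℓ : List (ℕ × Tens 𝕜 X)) :
    val (p :: ℓ) = p.2 * val ℓ := by simp [val]

@[simp] theorem val_append (ℓ ℓ' : List (ℕ × Tens 𝕜 X)) : val (ℓ ++ ℓ') = val ℓ * val ℓ' := by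
  simp [val]

@[simp] theorem degs_nil : degs ([] : List (ℕ × Tens 𝕜 X)) = 0 := rfl

@[simp] theorem degs_cons (p : ℕ × Tens 𝕜 X) (ℓ : List (ℕ × Tens 𝕜 X)) :
    degs (p :: ℓ) = p.1 ::ₘ degs ℓ := rfl

theorem IsLieList.perm {ℓ ℓ' : List (ℕ × Tens 𝕜 X)} (h : IsLieList ℓ) (hp : ℓ.Perm ℓ') :
    IsLieList ℓ' := fun p hm => h p (hp.mem_iff.2 hm)

theorem isLieList_cons {p : ℕ × Tens 𝕜 X} {ℓ : List (ℕ × Tens 𝕜 X)} :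
    IsLieList (p :: ℓ) ↔ IsLie p.1 p.2 ∧ IsLieList ℓ := by
  simp [IsLieList]

theorem isLieList_append {ℓ ℓ' : List (ℕ × Tens 𝕜 X)} :
    IsLieList (ℓ ++ ℓ') ↔ IsLieList ℓ ∧ IsLieList ℓ' := by
  simp only [IsLieList, List.mem_append]
  exact ⟨fun h => ⟨fun p hp => h p (.inl hp), fun p hp => h p (.inr hp)⟩,
    fun h p hp => hp.elim (h.1 p) (h.2 p)⟩

/-- All the ways to split a list into two complementary sublists. -/
def unshuffles {α : Type*} : List α → List (List α × List α)
  | [] => [([], [])]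
  | a :: l => (unshuffles l).map (fun p => (a :: p.1, p.2)) ++
      (unshuffles l).map (fun p => (p.1, a :: p.2))

theorem perm_of_mem_unshuffles {α : Type*} {l : List α} {p : List α × List α}
    (h : p ∈ unshuffles l) : (p.1 ++ p.2).Perm l := by
  induction l generalizing p with
  | nil => simp [unshuffles] at h; simp [h]
  | cons a l ih =>
    simp only [unshuffles, List.mem_append, List.mem_map] at h
    rcases h with ⟨q, hq, rfl⟩ | ⟨q, hq, rfl⟩
    · exact (ih hq).cons a
    · exact List.perm_middle.trans ((ih hq).cons a)

/-- Unshuffling a list amounts to splitting the multiset of its labels. -/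
theorem map_unshuffles {α β : Type*} (f : α → β) (l : List α) :
    (((unshuffles l).map fun p => (((p.1.map f : List β) : Multiset β),
      ((p.2.map f : List β) : Multiset β)) : List _) : Multiset (Multiset β × Multiset β)) =
      Multiset.antidiagonal (l.map f : List β) := by
  induction l with
  | nil => simp [unshuffles]
  | cons a l ih =>
    rw [List.map_cons, ← Multiset.cons_coe, Multiset.antidiagonal_cons, ← ih, unshuffles,
      List.map_append, ← Multiset.coe_add, add_comm]
    simp [List.map_map, Function.comp_def]

theorem comul_val {ℓ : List (ℕ × Tens 𝕜 X)} (h : IsLieList ℓ) :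
    comul 𝕜 (val ℓ) = ((unshuffles ℓ).map fun p => val p.1 ⊗ₜ[𝕜] val p.2).sum := by
  induction ℓ with
  | nil => simp [unshuffles, Algebra.TensorProduct.one_def]
  | cons p ℓ ih =>
    rw [isLieList_cons] at h
    rw [val_cons, map_mul, ih h.2, h.1.primitive, add_mul, unshuffles, List.map_append,
      List.sum_append, List.map_map, List.map_map, ← List.sum_map_mul_left,
      ← List.sum_map_mul_left]
    simp [Function.comp_def]

/-- A convolution acts on a product of primitive elements by splitting the factors. -/
theorem conv_val (f g : Tens 𝕜 X →ₗ[𝕜] Tens 𝕜 X) {ℓ : List (ℕ × Tens 𝕜 X)} (h : IsLieList ℓ) :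
    conv f g (val ℓ) = ((unshuffles ℓ).map fun p => f (val p.1) * g (val p.2)).sum := by
  simp only [conv, LinearMap.comp_apply, AlgHom.toLinearMap_apply]
  rw [comul_val h, map_list_sum, map_list_sum, List.map_map, List.map_map]
  simp [Function.comp_def]

/-- A word is a product of letters. -/
def letters (𝕜 : Type*) [Field 𝕜] (w : List X) : List (ℕ × Tens 𝕜 X) :=
  w.map fun x => (1, wordOf 𝕜 [x])

theorem isLieList_letters (w : List X) : IsLieList (letters 𝕜 w) := by
  intro p hp
  obtain ⟨x, -, rfl⟩ := List.mem_map.1 hp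
  exact isLie_letter x

theorem val_letters (w : List X) : val (letters 𝕜 w) = wordOf 𝕜 w := by
  induction w with
  | nil => simp [letters, wordOf_nil]
  | cons x w ih => rw [wordOf_cons, ← ih]; simp [letters]

theorem unshuffles_map {α β : Type*} (f : α → β) (l : List α) :
    unshuffles (l.map f) = (unshuffles l).map fun p => (p.1.map f, p.2.map f) := by
  induction l with
  | nil => rfl
  | cons a l ih => simp [unshuffles, ih, Function.comp_def]

theorem conv_wordOf (f g : Tens 𝕜 X →ₗ[𝕜] Tens 𝕜 X) (w : List X) :
    conv f g (wordOf 𝕜 w) =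
      ((unshuffles w).map fun p => f (wordOf 𝕜 p.1) * g (wordOf 𝕜 p.2)).sum := by
  rw [← val_letters, conv_val f g (isLieList_letters w), letters, unshuffles_map, List.map_map]
  refine congrArg List.sum (List.map_congr_left fun p _ => ?_)
  change f (val (letters 𝕜 p.1)) * g (val (letters 𝕜 p.2)) = _
  rw [val_letters, val_letters]

theorem grade_val {ℓ : List (ℕ × Tens 𝕜 X)} (h : IsLieList ℓ) :
    grade 𝕜 (val ℓ) = Polynomial.monomial (degs ℓ).sum (val ℓ) := by
  induction ℓ with
  | nil => simp
  | cons p ℓ ih =>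
    rw [isLieList_cons] at h
    rw [val_cons, map_mul, ih h.2, h.1.homogeneous, Polynomial.monomial_mul_monomial]
    simp

theorem proj_val (b : ℕ) {ℓ : List (ℕ × Tens 𝕜 X)} (h : IsLieList ℓ) :
    proj 𝕜 b (val ℓ) = (if (degs ℓ).sum = b then 1 else 0 : 𝕜) • val ℓ := by
  rw [proj_apply, grade_val h, Polynomial.coeff_monomial]
  split_ifs <;> simp

theorem proj_wordOf (b : ℕ) (w : List X) :
    proj 𝕜 b (wordOf 𝕜 w) = if w.length = b then wordOf 𝕜 w else 0 := by
  rw [← val_letters, proj_val b (isLieList_letters w)]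
  have : (degs (letters 𝕜 w)).sum = w.length := by
    induction w with
    | nil => rfl
    | cons x w ih => simp only [letters, List.map_cons, degs_cons, Multiset.sum_cons] at ih ⊢
                     rw [ih]; simp [add_comm]
  rw [this]
  split_ifs <;> simp

theorem rev_wordOf (w : List X) : rev 𝕜 (wordOf 𝕜 w) = wordOf 𝕜 w.reverse := by
  induction w with
  | nil => simp [wordOf_nil, rev_one]
  | cons x w ih =>
    rw [wordOf_cons, rev_mul, ih, rev_letter, List.reverse_cons, wordOf_append]

/-! ### The filtration by the number of Lie factors -/

variable (𝕜 X) in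
/-- The span of the products of fewer than `j` Lie elements. -/
def lieFil (j : ℕ) : Submodule 𝕜 (Tens 𝕜 X) :=
  Submodule.span 𝕜 {t | ∃ ℓ, IsLieList ℓ ∧ ℓ.length < j ∧ val ℓ = t}

theorem val_mem_lieFil {ℓ : List (ℕ × Tens 𝕜 X)} (h : IsLieList ℓ) {j : ℕ} (hj : ℓ.length < j) :
    val ℓ ∈ lieFil 𝕜 X j := Submodule.subset_span ⟨ℓ, h, hj, rfl⟩

theorem lieFil_mono {i j : ℕ} (h : i ≤ j) : lieFil 𝕜 X i ≤ lieFil 𝕜 X j :=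
  Submodule.span_mono fun _ ⟨ℓ, h1, h2, h3⟩ => ⟨ℓ, h1, by omega, h3⟩

/-- At most `i - 1` and at most `j - 1` factors make at most `i + j - 2` factors. -/
theorem mul_mem_lieFil {i j : ℕ} {a b : Tens 𝕜 X} (ha : a ∈ lieFil 𝕜 X i)
    (hb : b ∈ lieFil 𝕜 X j) : a * b ∈ lieFil 𝕜 X (i + j - 1) := by
  have := Submodule.mul_mem_mul ha hb
  rw [lieFil, lieFil, Submodule.span_mul_span] at this
  refine Submodule.span_mono ?_ this
  rintro _ ⟨_, ⟨ℓ, h1, h2, rfl⟩, _, ⟨ℓ', h1', h2', rfl⟩, rfl⟩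
  exact ⟨ℓ ++ ℓ', isLieList_append.2 ⟨h1, h1'⟩, by rw [List.length_append]; omega, by simp⟩

/-- Lie elements commute up to products of fewer Lie elements. -/
theorem val_sub_val_mem_lieFil {ℓ ℓ' : List (ℕ × Tens 𝕜 X)} (hp : ℓ.Perm ℓ') (h : IsLieList ℓ) :
    val ℓ - val ℓ' ∈ lieFil 𝕜 X ℓ.length := by
  induction hp with
  | nil => simp
  | cons p _ ih =>
    rw [isLieList_cons] at h
    have h1 : val [p] ∈ lieFil 𝕜 X 2 :=
      val_mem_lieFil (isLieList_cons.2 ⟨h.1, by simp [IsLieList]⟩) (by simp)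
    have := mul_mem_lieFil h1 (ih h.2)
    rw [mul_sub] at this
    simp only [val_cons, val_nil, mul_one] at this ⊢
    exact lieFil_mono (by rw [List.length_cons]; omega) this
  | swap p q ℓ =>
    rw [isLieList_cons, isLieList_cons] at h
    have h1 : IsLieList ((q.1 + p.1, q.2 * p.2 - p.2 * q.2) :: ℓ) :=
      isLieList_cons.2 ⟨h.1.bracket h.2.1, h.2.2⟩
    have := val_mem_lieFil h1 (j := (q :: p :: ℓ).length) (by simp)
    simp only [val_cons, sub_mul, mul_assoc] at this ⊢
    exact this
  | trans h1 h2 ih1 ih2 =>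
    have := Submodule.add_mem _ (ih1 h) (h1.length_eq ▸ ih2 (h.perm h1))
    rwa [sub_add_sub_cancel] at this

/-- A linear endomorphism `f` of the tensor algebra is triangular with eigenvalues `c` if it maps
each product of Lie elements to its multiple by `c`, applied to the multiset of their degrees, up
to products of fewer Lie elements. -/
def Triangular (f : Tens 𝕜 X →ₗ[𝕜] Tens 𝕜 X) (c : Multiset ℕ → 𝕜) : Prop :=
  ∀ ℓ, IsLieList ℓ → f (val ℓ) - c (degs ℓ) • val ℓ ∈ lieFil 𝕜 X ℓ.length

theorem Triangular.apply_val_mem {f : Tens 𝕜 X →ₗ[𝕜] Tens 𝕜 X} {c : Multiset ℕ → 𝕜}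
    (hf : Triangular f c) {ℓ : List (ℕ × Tens 𝕜 X)} (h : IsLieList ℓ) :
    f (val ℓ) ∈ lieFil 𝕜 X (ℓ.length + 1) := by
  have h1 := lieFil_mono (Nat.le_succ _) (hf ℓ h)
  have h2 := Submodule.smul_mem _ (c (degs ℓ)) (val_mem_lieFil h (Nat.lt_succ_self _))
  simpa using Submodule.add_mem _ h1 h2

theorem Triangular.map_lieFil {f : Tens 𝕜 X →ₗ[𝕜] Tens 𝕜 X} {c : Multiset ℕ → 𝕜}
    (hf : Triangular f c) {j : ℕ} {t : Tens 𝕜 X} (ht : t ∈ lieFil 𝕜 X j) :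
    f t ∈ lieFil 𝕜 X j := by
  have : lieFil 𝕜 X j ≤ (lieFil 𝕜 X j).comap f := by
    refine Submodule.span_le.2 ?_
    rintro _ ⟨ℓ, h1, h2, rfl⟩
    exact lieFil_mono (by omega) (hf.apply_val_mem h1)
  exact this ht

theorem Triangular.zero : Triangular (0 : Tens 𝕜 X →ₗ[𝕜] Tens 𝕜 X) 0 := fun ℓ _ => by simp

theorem Triangular.id : Triangular (LinearMap.id : Tens 𝕜 X →ₗ[𝕜] Tens 𝕜 X) 1 := fun ℓ _ => by
  simp

theorem Triangular.add {f g : Tens 𝕜 X →ₗ[𝕜] Tens 𝕜 X} {c d : Multiset ℕ → 𝕜}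
    (hf : Triangular f c) (hg : Triangular g d) : Triangular (f + g) (c + d) := fun ℓ h => by
  have := Submodule.add_mem _ (hf ℓ h) (hg ℓ h)
  rwa [sub_add_sub_comm, ← add_smul] at this

theorem Triangular.smul {f : Tens 𝕜 X →ₗ[𝕜] Tens 𝕜 X} {c : Multiset ℕ → 𝕜}
    (hf : Triangular f c) (a : 𝕜) : Triangular (a • f) (a • c) := fun ℓ h => by
  have := Submodule.smul_mem _ a (hf ℓ h)
  rwa [smul_sub, smul_smul] at this

theorem Triangular.comp {f g : Tens 𝕜 X →ₗ[𝕜] Tens 𝕜 X} {c d : Multiset ℕ → 𝕜}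
    (hf : Triangular f c) (hg : Triangular g d) : Triangular (f ∘ₗ g) (c * d) := fun ℓ h => by
  have h1 := hf.map_lieFil (hg ℓ h)
  have h2 := Submodule.smul_mem _ (d (degs ℓ)) (hf ℓ h)
  have := Submodule.add_mem _ h1 h2
  rwa [map_sub, map_smul, smul_sub, smul_smul, sub_add_sub_cancel, mul_comm] at this

theorem triangular_proj (b : ℕ) :
    Triangular (proj 𝕜 b : Tens 𝕜 X →ₗ[𝕜] _) fun m => if m.sum = b then 1 else 0 := fun ℓ h => by
  simp only [proj_val b h, sub_self, Submodule.zero_mem]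

theorem rev_val {ℓ : List (ℕ × Tens 𝕜 X)} (h : IsLieList ℓ) :
    rev 𝕜 (val ℓ) = ((degs ℓ).map fun d => (-1 : 𝕜) ^ (d + 1)).prod • val ℓ.reverse := by
  induction ℓ with
  | nil => simp [rev_one]
  | cons p ℓ ih =>
    rw [isLieList_cons] at h
    rw [val_cons, rev_mul, ih h.2, h.1.reversal, smul_mul_smul_comm, List.reverse_cons, degs_cons,
      Multiset.map_cons, Multiset.prod_cons, val_append, mul_comm]
    simp

theorem triangular_rev : Triangular (rev 𝕜 : Tens 𝕜 X →ₗ[𝕜] _) fun m =>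
    (m.map fun d => (-1 : 𝕜) ^ (d + 1)).prod := fun ℓ h => by
  simp only [rev_val h, ← smul_sub]
  refine Submodule.smul_mem _ _ ?_
  have := val_sub_val_mem_lieFil (List.reverse_perm ℓ) (h.perm (List.reverse_perm ℓ).symm)
  rwa [List.length_reverse] at this

/-- The eigenvalues of a convolution of two triangular endomorphisms. -/
def convCoeff (c d : Multiset ℕ → 𝕜) (m : Multiset ℕ) : 𝕜 :=
  (m.antidiagonal.map fun p => c p.1 * d p.2).sum

theorem convCoeff_degs (c d : Multiset ℕ → 𝕜) (ℓ : List (ℕ × Tens 𝕜 X)) :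
    convCoeff c d (degs ℓ) =
      ((unshuffles ℓ).map fun p => c (degs p.1) * d (degs p.2)).sum := by
  rw [convCoeff, degs, ← map_unshuffles]
  simp [Function.comp_def, degs]

theorem Triangular.conv {f g : Tens 𝕜 X →ₗ[𝕜] Tens 𝕜 X} {c d : Multiset ℕ → 𝕜}
    (hf : Triangular f c) (hg : Triangular g d) :
    Triangular (conv f g) (convCoeff c d) := fun ℓ h => by
  have key : ∀ p ∈ unshuffles ℓ,
      f (val p.1) * g (val p.2) - (c (degs p.1) * d (degs p.2)) • val ℓ ∈
        lieFil 𝕜 X ℓ.length := by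
    intro p hp
    have hperm := perm_of_mem_unshuffles hp
    have hlie := h.perm hperm.symm
    have hlen : p.1.length + p.2.length = ℓ.length := by
      rw [← hperm.length_eq, List.length_append]
    obtain ⟨h1, h2⟩ := isLieList_append.1 hlie
    have e1 := mul_mem_lieFil (hf _ h1) (hg.apply_val_mem h2)
    have e2 := Submodule.smul_mem _ (c (degs p.1))
      (mul_mem_lieFil (val_mem_lieFil h1 (Nat.lt_succ_self _)) (hg _ h2))
    have e3 := Submodule.smul_mem _ (c (degs p.1) * d (degs p.2))
      (val_sub_val_mem_lieFil hperm hlie)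
    rw [hperm.length_eq, val_append] at e3
    have := Submodule.add_mem _ (Submodule.add_mem _ (lieFil_mono (by omega) e1)
      (lieFil_mono (by omega) e2)) e3
    convert this using 1
    simp only [sub_mul, mul_sub, smul_sub, smul_mul_assoc, mul_smul_comm, mul_smul]
    abel
  rw [conv_val f g h, convCoeff_degs]
  generalize unshuffles ℓ = u at key
  induction u with
  | nil => simp
  | cons p u ih =>
    have := Submodule.add_mem _ (key p (by simp)) (ih fun q hq => key q (List.mem_cons_of_mem _ hq))
    rwa [sub_add_sub_comm, ← add_smul] at this

end Tensor

noncomputable section Kernels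

variable {𝕜 : Type*} [Field 𝕜] {X : Type*}

/-! ### Coefficients of the operators on increasing words -/

theorem sublist_of_mem_unshuffles {α : Type*} {l : List α} {p : List α × List α}
    (h : p ∈ unshuffles l) : p.1.Sublist l ∧ p.2.Sublist l := by
  induction l generalizing p with
  | nil => simp [unshuffles] at h; simp [h]
  | cons a l ih =>
    simp only [unshuffles, List.mem_append, List.mem_map] at h
    rcases h with ⟨q, hq, rfl⟩ | ⟨q, hq, rfl⟩
    · exact ⟨(ih hq).1.cons_cons a, (ih hq).2.cons a⟩
    · exact ⟨(ih hq).1.cons a, (ih hq).2.cons_cons a⟩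

theorem coeff_mul_splits (a b : Tens 𝕜 X) (z : List X) :
    (a * b).coeff (FreeMonoid.ofList z) = ∑ i ∈ Finset.range (z.length + 1),
      a.coeff (FreeMonoid.ofList (z.take i)) * b.coeff (FreeMonoid.ofList (z.drop i)) := by
  classical
  rw [MonoidAlgebra.coeff_mul_antidiag a b _ ((Finset.range (z.length + 1)).image fun i =>
    (FreeMonoid.ofList (z.take i), FreeMonoid.ofList (z.drop i))), Finset.sum_image]
  · intro i hi j hj h
    have := congrArg (fun u => (FreeMonoid.toList u).length) (Prod.mk.inj h).1
    simp only [Finset.coe_range, Set.mem_Iio] at hi hj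
    simp only [FreeMonoid.toList_ofList, List.length_take] at this
    omega
  · rintro ⟨u, v⟩
    simp only [Finset.mem_image, Finset.mem_range, Prod.mk.injEq]
    constructor
    · rintro ⟨i, -, rfl, rfl⟩
      rw [← FreeMonoid.ofList_append, List.take_append_drop]
    · intro h
      have h' : FreeMonoid.toList u ++ FreeMonoid.toList v = z := by
        rw [← FreeMonoid.toList_mul, h, FreeMonoid.toList_ofList]
      refine ⟨(FreeMonoid.toList u).length, ?_, ?_, ?_⟩
      · rw [← h', List.length_append]; omega
      · rw [← h', List.take_left, FreeMonoid.ofList_toList]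
      · rw [← h', List.drop_left, FreeMonoid.ofList_toList]

/-- A word without repetitions can be split in exactly one way into two words with prescribed
letters. -/
theorem sum_unshuffles_perm [DecidableEq X] {w : List X} (hw : w.Nodup) (u v : List X) :
    ((unshuffles w).map fun p =>
      if u.Perm p.1 ∧ v.Perm p.2 then (1 : 𝕜) else 0).sum =
      if (u ++ v).Perm w then 1 else 0 := by
  have h1 : ((unshuffles w).map fun p =>
      if u.Perm p.1 ∧ v.Perm p.2 then (1 : 𝕜) else 0).sum =
      ((Multiset.antidiagonal (w : Multiset X)).map fun q =>
        if ((u : Multiset X), (v : Multiset X)) = q then (1 : 𝕜) else 0).sum := by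
    have := map_unshuffles (fun x : X => x) w
    simp only [List.map_id'] at this
    rw [← this]
    simp [Function.comp_def]
  have hnd : (Multiset.antidiagonal (w : Multiset X)).Nodup := by
    refine Multiset.Nodup.of_map Prod.fst ?_
    rw [Multiset.antidiagonal_map_fst, Multiset.nodup_powerset, Multiset.coe_nodup]
    exact hw
  rw [h1]
  change Finset.sum ⟨_, hnd⟩ _ = _
  have hmem : ((u : Multiset X), (v : Multiset X)) ∈
      (⟨_, hnd⟩ : Finset (Multiset X × Multiset X)) ↔ (u ++ v).Perm w := by
    rw [Finset.mem_mk, Multiset.mem_antidiagonal, Multiset.coe_add, Multiset.coe_eq_coe]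
  rw [Finset.sum_ite_eq]
  simp only [hmem]

variable [LinearOrder X]

/-- The linear endomorphism `f` maps each strictly increasing word `w` to the sum of the
rearrangements `z` of `w` with coefficients `c z`. -/
def HasKernel (f : Tens 𝕜 X →ₗ[𝕜] Tens 𝕜 X) (c : List X → 𝕜) : Prop :=
  ∀ w : List X, w.Pairwise (· < ·) → ∀ z : List X,
    (f (wordOf 𝕜 w)).coeff (FreeMonoid.ofList z) = if z.Perm w then c z else 0

/-- The convolution of coefficient functions dual to deconcatenation of words. -/
def convKernel (c d : List X → 𝕜) (z : List X) : 𝕜 :=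
  ∑ i ∈ Finset.range (z.length + 1), c (z.take i) * d (z.drop i)

theorem HasKernel.conv {f g : Tens 𝕜 X →ₗ[𝕜] Tens 𝕜 X} {c d : List X → 𝕜}
    (hf : HasKernel f c) (hg : HasKernel g d) : HasKernel (conv f g) (convKernel c d) := by
  intro w hw z
  have hnd : w.Nodup := hw.imp fun h => h.ne
  have h1 : (PeakAlgebra.conv f g (wordOf 𝕜 w)).coeff (FreeMonoid.ofList z) =
      ((unshuffles w).map fun p => ∑ i ∈ Finset.range (z.length + 1),
        (if (z.take i).Perm p.1 ∧ (z.drop i).Perm p.2 then (1 : 𝕜) else 0) *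
          (c (z.take i) * d (z.drop i))).sum := by
    rw [conv_wordOf]
    have : ∀ l : List (Tens 𝕜 X), l.sum.coeff (FreeMonoid.ofList z) =
        (l.map fun t => t.coeff (FreeMonoid.ofList z)).sum := fun l => by
      induction l with
      | nil => simp
      | cons a l ih => simp [ih]
    rw [this, List.map_map]
    refine congrArg List.sum (List.map_congr_left fun p hp => ?_)
    have hp' := sublist_of_mem_unshuffles hp
    rw [Function.comp_apply, coeff_mul_splits]
    refine Finset.sum_congr rfl fun i _ => ?_
    rw [hf _ (hw.sublist hp'.1), hg _ (hw.sublist hp'.2)]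
    split_ifs <;> simp_all
  have h2 : ∀ (l : List (List X × List X)) (s : Finset ℕ) (F : List X × List X → ℕ → 𝕜),
      (l.map fun p => ∑ i ∈ s, F p i).sum = ∑ i ∈ s, (l.map fun p => F p i).sum := by
    intro l s F
    induction l with
    | nil => simp
    | cons a l ih => simp [ih, Finset.sum_add_distrib]
  have h3 : ∀ i, ((unshuffles w).map fun p =>
      (if (z.take i).Perm p.1 ∧ (z.drop i).Perm p.2 then (1 : 𝕜) else 0) *
        (c (z.take i) * d (z.drop i))).sum =
      (if z.Perm w then 1 else 0) * (c (z.take i) * d (z.drop i)) := fun i => by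
    rw [List.sum_map_mul_right, sum_unshuffles_perm hnd, List.take_append_drop]
  simp only [h1, h2, h3, convKernel, ← Finset.mul_sum]
  split_ifs <;> simp

theorem HasKernel.comp_proj {f : Tens 𝕜 X →ₗ[𝕜] Tens 𝕜 X} {c : List X → 𝕜}
    (hf : HasKernel f c) (b : ℕ) :
    HasKernel (f ∘ₗ proj 𝕜 b) fun z => if z.length = b then c z else 0 := by
  intro w hw z
  rw [LinearMap.comp_apply, proj_wordOf]
  by_cases hp : z.Perm w
  · simp only [if_pos hp, hp.length_eq]
    split_ifs with h
    · rw [hf w hw, if_pos hp]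
    · simp
  · rw [if_neg hp]
    split_ifs with h
    · rw [hf w hw, if_neg hp]
    · simp

theorem hasKernel_id : HasKernel (LinearMap.id : Tens 𝕜 X →ₗ[𝕜] Tens 𝕜 X) fun z =>
    if z.Pairwise (· < ·) then 1 else 0 := by
  intro w hw z
  rw [LinearMap.id_apply, coeff_wordOf]
  by_cases h : z = w
  · subst h; simp [hw]
  · rw [if_neg h]
    dsimp only
    split_ifs with h1 h2
    · exact absurd (h1.eq_of_pairwise' h2 hw) h
    · rfl
    · rfl

theorem hasKernel_rev : HasKernel (rev 𝕜 : Tens 𝕜 X →ₗ[𝕜] Tens 𝕜 X) fun z =>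
    if z.Pairwise (· > ·) then 1 else 0 := by
  intro w hw z
  have hw' : w.reverse.Pairwise (· > ·) := List.pairwise_reverse.2 hw
  rw [rev_wordOf, coeff_wordOf]
  by_cases h : z = w.reverse
  · subst h; simp only [if_pos (List.reverse_perm w), if_pos hw', if_true]
  · rw [if_neg h]
    dsimp only
    split_ifs with h1 h2
    · exact absurd ((h1.trans (List.reverse_perm w).symm).eq_of_pairwise' h2 hw') h
    · rfl
    · rfl

/-! ### V-shaped words -/

/-- The number of ways to write a word as a decreasing word followed by an increasing word. -/
def veeCount (𝕜 : Type*) [Field 𝕜] : List X → 𝕜 :=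
  convKernel (fun z => if z.Pairwise (· > ·) then 1 else 0)
    fun z => if z.Pairwise (· < ·) then 1 else 0

theorem veeCount_cons (x : X) (u : List X) : veeCount 𝕜 (x :: u) =
    (if (x :: u).Pairwise (· < ·) then 1 else 0) + ∑ i ∈ Finset.range (u.length + 1),
      (if (x :: u.take i).Pairwise (· > ·) then 1 else 0) *
        (if (u.drop i).Pairwise (· < ·) then 1 else 0) := by
  rw [veeCount, convKernel, List.length_cons, Finset.sum_range_succ']
  simp [add_comm]

theorem veeCount_singleton (x : X) : veeCount 𝕜 [x] = 2 := by
  rw [veeCount_cons]; norm_num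

theorem pairwise_cons_cons_iff {X : Type*} {r : X → X → Prop} [IsTrans X r] {x y : X} {u : List X} :
    (x :: y :: u).Pairwise r ↔ r x y ∧ (y :: u).Pairwise r := by
  rw [← List.isChain_iff_pairwise, ← List.isChain_iff_pairwise, List.isChain_cons_cons]

theorem veeCount_cons_cons {x y : X} (hxy : x ≠ y) (u : List X) :
    veeCount 𝕜 (x :: y :: u) =
      if x < y then 2 * (if (y :: u).Pairwise (· < ·) then 1 else 0) else
        veeCount 𝕜 (y :: u) := by
  rw [veeCount_cons, veeCount_cons, List.length_cons, Finset.sum_range_succ']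
  simp only [List.take_succ_cons, List.drop_succ_cons, List.take_zero, List.drop_zero,
    pairwise_cons_cons_iff, List.pairwise_singleton, if_true, one_mul]
  rcases lt_or_gt_of_ne hxy with h | h
  · simp only [h, not_lt_of_gt h, gt_iff_lt, true_and, false_and, if_false, if_true, zero_mul,
      Finset.sum_const_zero]
    ring
  · simp only [h, not_lt_of_gt h, gt_iff_lt, true_and, false_and, if_false]
    ring

end Kernels

noncomputable section Peaks

/-- The word has no peak in its interior. -/
def NoPeak (z : List ℕ) : Prop :=
  ∀ i, i + 2 < z.length → ¬ (z.getD i 0 < z.getD (i + 1) 0 ∧ z.getD (i + 2) 0 < z.getD (i + 1) 0)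

instance : DecidablePred NoPeak := Classical.decPred _

theorem noPeak_cons_cons {x y : ℕ} {u : List ℕ} :
    NoPeak (x :: y :: u) ↔ (∀ w ∈ u.head?, ¬ (x < y ∧ w < y)) ∧ NoPeak (y :: u) := by
  constructor
  · intro h
    refine ⟨?_, fun i hi => ?_⟩
    · intro w hw
      cases u with
      | nil => simp at hw
      | cons w' u =>
        simp at hw
        subst hw
        simpa using h 0 (by simp)
    · simpa using h (i + 1) (by simpa using hi)
  · rintro ⟨h1, h2⟩ i hi
    cases i with
    | zero =>
      cases u with
      | nil => simp at hi
      | cons w' u => simpa using h1 w' (by simp)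
    | succ i => simpa using h2 i (by simpa using hi)

/-- A word without peaks which starts with an ascent is increasing. -/
theorem noPeak_of_lt {x y : ℕ} {u : List ℕ} (hxy : x < y) (h : (y :: u).Nodup) :
    NoPeak (x :: y :: u) ↔ (y :: u).Pairwise (· < ·) := by
  induction u generalizing x y with
  | nil => simp [NoPeak]
  | cons w u ih =>
    rw [noPeak_cons_cons, pairwise_cons_cons_iff]
    have hne : y ≠ w := by rintro rfl; simp at h
    rcases lt_or_gt_of_ne hne with hlt | hlt
    · rw [ih hlt (List.nodup_cons.1 h).2]
      simp only [List.head?_cons, Option.mem_some_iff, forall_eq', hlt, true_and]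
      exact and_iff_right (by omega)
    · simp [hxy, hlt, not_lt_of_gt hlt]

/-- A nonempty word without repetitions is V-shaped if it has no peak in its interior. It is then
counted twice, since its least letter can be assigned to either of the two parts. -/
theorem veeCount_eq (𝕜 : Type*) [Field 𝕜] {z : List ℕ} (h : z.Nodup) (h0 : z ≠ []) :
    veeCount 𝕜 z = if NoPeak z then 2 else 0 := by
  induction z with
  | nil => exact absurd rfl h0
  | cons x u ih =>
    cases u with
    | nil => rw [veeCount_singleton, if_pos]; intro i hi; simp at hi
    | cons y u =>
      have hne : x ≠ y := by rintro rfl; simp at h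
      have hu := (List.nodup_cons.1 h).2
      rw [veeCount_cons_cons hne]
      rcases lt_or_gt_of_ne hne with h1 | h1
      · simp only [h1, if_true, noPeak_of_lt h1 hu, mul_ite, mul_one, mul_zero]
      · rw [if_neg (not_lt_of_gt h1), ih hu (by simp)]
        have : NoPeak (x :: y :: u) ↔ NoPeak (y :: u) := by
          rw [noPeak_cons_cons]
          exact and_iff_right fun _ _ h2 => absurd h2.1 (not_lt_of_gt h1)
        simp only [this]

end Peaks

noncomputable section Operators

/-! ### The operators attached to pseudo-compositions -/

section Eigenvalues

variable (𝕜 : Type*) [Field 𝕜] {X : Type*}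

/-- The operator which maps an increasing word of length `b` to the sum of its V-shaped
rearrangements, each with multiplicity two if `b ≥ 1`. -/
def veeOp (b : ℕ) : Tens 𝕜 X →ₗ[𝕜] Tens 𝕜 X := conv (rev 𝕜) LinearMap.id ∘ₗ proj 𝕜 b

/-- The convolution of the operators `veeOp` for the entries of a list. -/
def veesOp : List ℕ → (Tens 𝕜 X →ₗ[𝕜] Tens 𝕜 X)
  | [] => LinearMap.id ∘ₗ proj 𝕜 0
  | b :: bs => conv (veeOp 𝕜 b) (veesOp bs)

/-- The operator attached to the pseudo-composition `(b₀; b₁, …, b_l)`: an increasing word is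
mapped to the combination of its rearrangements that consist of an increasing word of length
`b₀`, followed by V-shaped words of lengths `b₁, …, b_l`. -/
def peakOp (b₀ : ℕ) (bs : List ℕ) : Tens 𝕜 X →ₗ[𝕜] Tens 𝕜 X :=
  conv (LinearMap.id ∘ₗ proj 𝕜 b₀) (veesOp 𝕜 bs)

/-- The eigenvalue of `proj b` on a product of Lie elements. -/
def projCoeff (b : ℕ) (m : Multiset ℕ) : 𝕜 := if m.sum = b then 1 else 0

/-- The eigenvalue of `veeOp b` on a product of Lie elements: the operator annihilates Lie elements
of even degree and doubles those of odd degree. -/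
def veeCoeff (b : ℕ) (m : Multiset ℕ) : 𝕜 :=
  projCoeff 𝕜 b m * (m.map fun d => (-1 : 𝕜) ^ (d + 1) + 1).prod

/-- The eigenvalue of `veesOp bs` on a product of Lie elements. -/
def veesCoeff : List ℕ → Multiset ℕ → 𝕜
  | [] => projCoeff 𝕜 0
  | b :: bs => convCoeff (veeCoeff 𝕜 b) (veesCoeff bs)

/-- The eigenvalue of `peakOp b₀ bs` on a product of Lie elements. -/
def peakCoeff (b₀ : ℕ) (bs : List ℕ) : Multiset ℕ → 𝕜 :=
  convCoeff (projCoeff 𝕜 b₀) (veesCoeff 𝕜 bs)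

theorem triangular_idProj (b : ℕ) :
    Triangular (LinearMap.id ∘ₗ proj 𝕜 b : Tens 𝕜 X →ₗ[𝕜] _) (projCoeff 𝕜 b) :=
  triangular_proj b

theorem triangular_veeOp (b : ℕ) :
    Triangular (veeOp 𝕜 b : Tens 𝕜 X →ₗ[𝕜] _) (veeCoeff 𝕜 b) := by
  have h : Triangular (veeOp 𝕜 b : Tens 𝕜 X →ₗ[𝕜] _) _ :=
    (triangular_rev.conv Triangular.id).comp (triangular_proj b)
  convert h using 1
  funext m
  rw [veeCoeff, mul_comm, Multiset.prod_map_add]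
  simp [convCoeff, projCoeff]

theorem triangular_veesOp : ∀ bs : List ℕ,
    Triangular (veesOp 𝕜 bs : Tens 𝕜 X →ₗ[𝕜] _) (veesCoeff 𝕜 bs)
  | [] => triangular_idProj 𝕜 0
  | b :: bs => (triangular_veeOp 𝕜 b).conv (triangular_veesOp bs)

theorem triangular_peakOp (b₀ : ℕ) (bs : List ℕ) :
    Triangular (peakOp 𝕜 b₀ bs : Tens 𝕜 X →ₗ[𝕜] _) (peakCoeff 𝕜 b₀ bs) :=
  (triangular_idProj 𝕜 b₀).conv (triangular_veesOp 𝕜 bs)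

end Eigenvalues

/-! ### Coefficients of these operators -/

section Coefficients

variable (𝕜 : Type*) [Field 𝕜]

/-- The coefficients of `veesOp bs` on increasing words. -/
def veesKernel : List ℕ → List ℕ → 𝕜
  | [], z => if z.length = 0 then (if z.Pairwise (· < ·) then 1 else 0) else 0
  | b :: bs, z =>
    convKernel (fun z => if z.length = b then veeCount 𝕜 z else 0) (veesKernel bs) z

theorem hasKernel_veesOp : ∀ bs : List ℕ,
    HasKernel (veesOp 𝕜 bs : Tens 𝕜 ℕ →ₗ[𝕜] _) (veesKernel 𝕜 bs)
  | [] => hasKernel_id.comp_proj 0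
  | b :: bs => ((hasKernel_rev.conv hasKernel_id).comp_proj b).conv (hasKernel_veesOp bs)

theorem hasKernel_peakOp (b₀ : ℕ) (bs : List ℕ) :
    HasKernel (peakOp 𝕜 b₀ bs : Tens 𝕜 ℕ →ₗ[𝕜] _) (convKernel
      (fun z => if z.length = b₀ then (if z.Pairwise (· < ·) then 1 else 0) else 0)
      (veesKernel 𝕜 bs)) :=
  (hasKernel_id.comp_proj b₀).conv (hasKernel_veesOp 𝕜 bs)

theorem convKernel_length {c d : List ℕ → 𝕜} {b : ℕ} {z : List ℕ} (h : b ≤ z.length) :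
    convKernel (fun z => if z.length = b then c z else 0) d z = c (z.take b) * d (z.drop b) := by
  rw [convKernel, Finset.sum_eq_single b]
  · simp [h]
  · intro i hi hb
    rw [Finset.mem_range] at hi
    rw [if_neg, zero_mul]
    rw [List.length_take]
    omega
  · intro hb
    rw [Finset.mem_range] at hb
    omega

/-- The blocks of lengths `bs` of a word have no peaks in their interiors. -/
def NoPeaks : List ℕ → List ℕ → Prop
  | [], _ => True
  | b :: bs, z => NoPeak (z.take b) ∧ NoPeaks bs (z.drop b)

instance (bs z : List ℕ) : Decidable (NoPeaks bs z) := Classical.dec _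

/-- On words without repetitions, each block contributes a factor `2`, as its length is positive. -/
theorem veesKernel_eq (bs : List ℕ) (hbs : ∀ b ∈ bs, 1 ≤ b) {z : List ℕ} (hz : z.Nodup)
    (hl : z.length = bs.sum) :
    veesKernel 𝕜 bs z = if NoPeaks bs z then 2 ^ bs.length else 0 := by
  induction bs generalizing z with
  | nil =>
    have : z = [] := List.length_eq_zero_iff.1 (by simpa using hl)
    subst this
    simp [veesKernel, NoPeaks]
  | cons b bs ih =>
    rw [List.sum_cons] at hl
    have hb := hbs b (by simp)
    have h0 : z.take b ≠ [] := by
      intro h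
      have := congrArg List.length h
      rw [List.length_take, List.length_nil] at this
      omega
    rw [veesKernel, convKernel_length 𝕜 (by omega),
      veeCount_eq 𝕜 (hz.sublist (List.take_sublist _ _)) h0,
      ih (fun b' h => hbs b' (by simp [h])) (hz.sublist (List.drop_sublist _ _))
        (by rw [List.length_drop]; omega)]
    simp only [NoPeaks, List.length_cons, pow_succ']
    split_ifs <;> simp_all

/-- The starting positions of the blocks of lengths `bs` that follow each other from position `s`
on. -/
def marks : ℕ → List ℕ → Finset ℕ
  | _, [] => ∅
  | s, b :: bs => insert s (marks (s + b) bs)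

theorem le_of_mem_marks {s : ℕ} {bs : List ℕ} {i : ℕ} (h : i ∈ marks s bs) : s ≤ i := by
  induction bs generalizing s with
  | nil => simp [marks] at h
  | cons b bs ih =>
    rw [marks, Finset.mem_insert] at h
    rcases h with rfl | h
    · exact le_rfl
    · have := ih h; omega

theorem noPeak_slice {z : List ℕ} {s b : ℕ} (h : s + b ≤ z.length) :
    NoPeak ((z.drop s).take b) ↔ ∀ p, s ≤ p → p + 2 < s + b →
      ¬ (z.getD p 0 < z.getD (p + 1) 0 ∧ z.getD (p + 2) 0 < z.getD (p + 1) 0) := by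
  have hl : ((z.drop s).take b).length = b := by
    rw [List.length_take, List.length_drop]; omega
  have hget : ∀ i, i < b → ((z.drop s).take b).getD i 0 = z.getD (s + i) 0 := fun i hi => by
    simp [List.getD_eq_getElem?_getD, hi]
  constructor
  · intro h1 p hp1 hp2
    obtain ⟨i, rfl⟩ := Nat.exists_eq_add_of_le hp1
    have := h1 i (by omega)
    rwa [hget _ (by omega), hget _ (by omega), hget _ (by omega)] at this
  · intro h1 i hi
    rw [hl] at hi
    rw [hget _ (by omega), hget _ (by omega), hget _ (by omega)]
    exact h1 (s + i) (by omega) (by omega)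

/-- The blocks which start in the position `s` have no peaks in their interiors if every peak of
the word that lies between two positions from `s` on is the first or the last letter of a block.
Here positions are counted from `0`, so that `p + 1` is the position of the peak. -/
theorem noPeaks_iff {z : List ℕ} {bs : List ℕ} (hbs : ∀ b ∈ bs, 1 ≤ b) {s : ℕ}
    (h : s + bs.sum = z.length) :
    NoPeaks bs (z.drop s) ↔ ∀ p, s ≤ p → p + 2 < z.length →
      (z.getD p 0 < z.getD (p + 1) 0 ∧ z.getD (p + 2) 0 < z.getD (p + 1) 0) →
        p + 2 ∈ marks s bs ∨ p + 1 ∈ marks s bs := by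
  induction bs generalizing s with
  | nil =>
    simp only [List.sum_nil] at h
    simp only [NoPeaks, true_iff]
    intro p h1 h2
    omega
  | cons b bs ih =>
    rw [List.sum_cons] at h
    have hb := hbs b (by simp)
    rw [NoPeaks, List.drop_drop, ih (fun b' h => hbs b' (by simp [h])) (by omega),
      noPeak_slice (by omega)]
    simp only [marks, Finset.mem_insert]
    have hmem : s + b < z.length → s + b ∈ marks (s + b) bs := by
      intro hlt
      cases bs with
      | nil => simp at h; omega
      | cons b' bs => simp [marks]
    constructor
    · rintro ⟨h1, h2⟩ p hp1 hp2 hp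
      by_cases c1 : p + 2 < s + b
      · exact absurd hp (h1 p hp1 c1)
      by_cases c2 : s + b ≤ p
      · rcases h2 p c2 hp2 hp with h3 | h3 <;> simp [h3]
      · have := hmem (by omega)
        have : p + 2 = s + b ∨ p + 1 = s + b := by omega
        rcases this with e | e <;> simp [e, hmem (by omega)]
    · intro h1
      refine ⟨fun p hp1 hp2 hp => ?_, fun p hp1 hp2 hp => ?_⟩
      · rcases h1 p hp1 (by omega) hp with (h2 | h2) | (h2 | h2)
        · omega
        · have := le_of_mem_marks h2; omega
        · omega
        · have := le_of_mem_marks h2; omega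
      · rcases h1 p (by omega) hp2 hp with (h2 | h2) | (h2 | h2)
        · omega
        · exact .inl h2
        · omega
        · exact .inr h2

/-! ### Words of permutations -/

variable {n : ℕ}

/-- The word `σ(1) ⋯ σ(n)` of a permutation, as a list. -/
def listWord (σ : Perm (Fin n)) : List ℕ := (List.range n).map fun i => word σ (i + 1)

theorem length_listWord (σ : Perm (Fin n)) : (listWord σ).length = n := by simp [listWord]

theorem getD_listWord (σ : Perm (Fin n)) (i : ℕ) : (listWord σ).getD i 0 = word σ (i + 1) := by
  by_cases h : i < n
  · simp [listWord, List.getD_eq_getElem?_getD, h]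
  · rw [List.getD_eq_default _ _ (by rw [length_listWord]; omega), word_of_gt σ (by omega)]

theorem nodup_listWord (σ : Perm (Fin n)) : (listWord σ).Nodup := by
  refine List.Nodup.map_on (fun i hi j hj h => ?_) List.nodup_range
  rw [List.mem_range] at hi hj
  have := word_injective σ (by omega) (by omega) (by omega) (by omega) h
  omega

theorem listWord_mul (σ τ : Perm (Fin n)) : listWord (σ * τ) = (listWord τ).map (word σ) := by
  simp [listWord, word_mul, Function.comp_def]

theorem listWord_injective : Function.Injective (listWord (n := n)) := fun σ τ h =>
  word_ext fun j h1 h2 => by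
    have := getD_listWord σ (j - 1)
    rw [h, getD_listWord, Nat.sub_add_cancel h1] at this
    exact this.symm

theorem listWord_one : listWord (1 : Perm (Fin n)) = (List.range n).map (· + 1) := by
  refine List.map_congr_left fun i hi => ?_
  rw [List.mem_range] at hi
  rw [word_one (by omega)]

theorem pairwise_listWord_one : (listWord (1 : Perm (Fin n))).Pairwise (· < ·) := by
  rw [listWord_one, List.pairwise_map]
  exact List.pairwise_lt_range.imp fun h => by omega

theorem listWord_perm (σ : Perm (Fin n)) : (listWord σ).Perm (listWord (1 : Perm (Fin n))) := by
  rw [List.perm_ext_iff_of_nodup (nodup_listWord _) (nodup_listWord _)]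
  intro v
  simp only [listWord, List.mem_map, List.mem_range]
  constructor
  · rintro ⟨i, hi, rfl⟩
    have := one_le_word σ (i := i + 1) (by omega) (by omega)
    have := word_le σ (i + 1)
    exact ⟨word σ (i + 1) - 1, by omega, by rw [word_one] <;> omega⟩
  · rintro ⟨i, hi, rfl⟩
    rw [word_one (by omega)]
    obtain ⟨j, h1, h2, h3⟩ := word_surjective σ (v := i + 1) (by omega) (by omega)
    exact ⟨j - 1, by omega, by rwa [Nat.sub_add_cancel h1]⟩

theorem exists_listWord_eq {z : List ℕ} (h : z.Perm (listWord (1 : Perm (Fin n)))) :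
    ∃ σ : Perm (Fin n), listWord σ = z := by
  have hl : z.length = n := by rw [h.length_eq, length_listWord]
  have hnd : z.Nodup := h.nodup_iff.2 (nodup_listWord _)
  have hmem : ∀ v ∈ z, 1 ≤ v ∧ v ≤ n := fun v hv => by
    have := h.mem_iff.1 hv
    rw [listWord_one, List.mem_map] at this
    obtain ⟨i, hi, rfl⟩ := this
    rw [List.mem_range] at hi
    omega
  let f : Fin n → Fin n := fun i => ⟨z[(i : ℕ)]'(by omega) - 1, by
    have := hmem _ (List.getElem_mem (l := z) (n := i) (by omega))
    omega⟩
  have hf : Function.Injective f := fun i j hij => by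
    have h1 := hmem _ (List.getElem_mem (l := z) (n := i) (by omega))
    have h2 := hmem _ (List.getElem_mem (l := z) (n := j) (by omega))
    have h3 : z[(i : ℕ)]'(by omega) - 1 = z[(j : ℕ)]'(by omega) - 1 := Fin.mk.inj hij
    exact Fin.ext ((List.Nodup.getElem_inj_iff hnd).1 (by omega))
  refine ⟨Equiv.ofBijective f (Finite.injective_iff_bijective.1 hf), ?_⟩
  refine List.ext_getElem (by rw [length_listWord, hl]) fun i h1 h2 => ?_
  have h3 := hmem _ (List.getElem_mem h2)
  rw [length_listWord] at h1
  simp only [listWord, List.getElem_map, List.getElem_range]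
  rw [word_eq _ (by omega) (by omega)]
  simp [f]
  omega

/-- The element of the group algebra attached to the pseudo-composition `(b₀; b₁, …, b_l)`: the
sum, multiplied by `2 ^ l`, of the permutations all of whose peaks are in one of the positions
`b₀, b₀ + b₁, …, b₀ + ⋯ + b_(l - 1)` or directly after one of them. -/
def markElt (n b₀ : ℕ) (bs : List ℕ) : MonoidAlgebra 𝕜 (Perm (Fin n)) :=
  ∑ σ : Perm (Fin n) with ∀ j ∈ peakSet σ, j ∈ marks b₀ bs ∨ j - 1 ∈ marks b₀ bs,
    MonoidAlgebra.single σ (2 ^ bs.length)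

theorem coeff_markElt (b₀ : ℕ) (bs : List ℕ) (σ : Perm (Fin n)) :
    (markElt 𝕜 n b₀ bs).coeff σ =
      if ∀ j ∈ peakSet σ, j ∈ marks b₀ bs ∨ j - 1 ∈ marks b₀ bs then 2 ^ bs.length else 0 := by
  classical
  rw [markElt, MonoidAlgebra.coeff_sum, Finsupp.finsetSum_apply]
  simp [Finsupp.single_apply, Finset.mem_filter]

/-- The embedding of the group algebra into the tensor algebra, as the span of the words of
permutations. -/
def toTens : MonoidAlgebra 𝕜 (Perm (Fin n)) →ₗ[𝕜] Tens 𝕜 ℕ :=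
  (Finsupp.linearCombination 𝕜 fun σ => wordOf 𝕜 (listWord σ)) ∘ₗ
    (MonoidAlgebra.coeffLinearEquiv 𝕜).toLinearMap

end Coefficients
end Operators

noncomputable section Realization

variable (𝕜 : Type*) [Field 𝕜] {n : ℕ}

/-! ### Realization of the peak algebra by operators on the tensor algebra -/

/-- The peaks of `σ` are at marked positions or directly after them if and only if the first block
of its word is increasing and the others are V-shaped. The first block is increasing if it has no
peak when the letter `0` is put in front of it. -/
theorem forall_mem_peakSet_iff (σ : Perm (Fin n)) {b₀ : ℕ} {bs : List ℕ} (hbs : ∀ b ∈ bs, 1 ≤ b)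
    (h : b₀ + bs.sum = n) :
    (∀ j ∈ peakSet σ, j ∈ marks b₀ bs ∨ j - 1 ∈ marks b₀ bs) ↔
      ((listWord σ).take b₀).Pairwise (· < ·) ∧ NoPeaks bs ((listWord σ).drop b₀) := by
  have hfirst : ((listWord σ).take b₀).Pairwise (· < ·) ↔
      NoPeak (((0 :: listWord σ).drop 0).take (b₀ + 1)) := by
    rw [List.drop_zero, List.take_succ_cons]
    have hnd := (nodup_listWord σ).sublist (List.take_sublist b₀ _)
    have hget := getD_listWord σ 0
    cases b₀ with
    | zero => simp [NoPeak]
    | succ b₀ =>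
      have := one_le_word σ (i := 0 + 1) (by omega) (by omega)
      cases hl : listWord σ with
      | nil => simp [NoPeak]
      | cons y u =>
        rw [hl] at hget hnd
        rw [List.take_succ_cons] at hnd ⊢
        rw [noPeak_of_lt _ hnd]
        rw [List.getD_cons_zero] at hget
        omega
  have hget : ∀ p, (0 :: listWord σ).getD p 0 = word σ p := fun p => by
    cases p with
    | zero => simp
    | succ p => rw [List.getD_cons_succ, getD_listWord]
  have hmem : b₀ < n → b₀ ∈ marks b₀ bs := by
    intro hlt
    cases bs with
    | nil => simp at h; omega
    | cons b' bs => simp [marks]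
  rw [hfirst, noPeak_slice (by rw [List.length_cons, length_listWord]; omega),
    noPeaks_iff hbs (by rw [length_listWord, h])]
  simp only [hget, getD_listWord, length_listWord, mem_peakSet]
  constructor
  · intro h1
    refine ⟨fun p _ hp2 hp => ?_, fun p hp1 hp2 hp => ?_⟩
    · rcases h1 (p + 1) ⟨by omega, by omega, hp⟩ with h2 | h2
      · have := le_of_mem_marks h2; omega
      · have := le_of_mem_marks h2; omega
    · exact h1 (p + 2) ⟨by omega, by omega, hp⟩
  · rintro ⟨h1, h2⟩ j ⟨hj1, hj2, hj⟩
    obtain ⟨p, rfl⟩ := Nat.exists_eq_add_of_le' hj1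
    by_cases c1 : p + 1 < b₀
    · exact absurd hj (h1 p (by omega) (by omega))
    by_cases c2 : p + 1 = b₀ ∨ p = b₀
    · have := hmem (by omega)
      rcases c2 with rfl | rfl
      · exact .inl this
      · exact .inr this
    · obtain ⟨q, rfl⟩ := Nat.exists_eq_add_of_le' (show 1 ≤ p by omega)
      exact h2 q (by omega) (by omega) hj

theorem toTens_single (σ : Perm (Fin n)) (a : 𝕜) :
    toTens 𝕜 (MonoidAlgebra.single σ a) = a • wordOf 𝕜 (listWord σ) := by
  simp [toTens, MonoidAlgebra.coeffLinearEquiv]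

theorem coeff_toTens (x : MonoidAlgebra 𝕜 (Perm (Fin n))) (σ : Perm (Fin n)) :
    (toTens 𝕜 x).coeff (FreeMonoid.ofList (listWord σ)) = x.coeff σ := by
  classical
  induction x using MonoidAlgebra.induction_linear with
  | zero => simp
  | add a b ha hb => simp [ha, hb]
  | single τ a =>
    rw [toTens_single, MonoidAlgebra.coeff_smul, Finsupp.smul_apply, coeff_wordOf,
      MonoidAlgebra.coeff_single, Finsupp.single_apply]
    simp [listWord_injective.eq_iff, eq_comm]

theorem coeff_toTens_eq_zero (x : MonoidAlgebra 𝕜 (Perm (Fin n))) {z : List ℕ}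
    (h : ¬ z.Perm (listWord (1 : Perm (Fin n)))) :
    (toTens 𝕜 x).coeff (FreeMonoid.ofList z) = 0 := by
  classical
  induction x using MonoidAlgebra.induction_linear with
  | zero => simp
  | add a b ha hb => simp [ha, hb]
  | single τ a =>
    rw [toTens_single, MonoidAlgebra.coeff_smul, Finsupp.smul_apply, coeff_wordOf, if_neg,
      smul_zero]
    rintro rfl
    exact h (listWord_perm τ)

theorem toTens_injective : Function.Injective (toTens 𝕜 (n := n)) := fun x y h => by
  ext σ
  rw [← coeff_toTens, h, coeff_toTens]

/-- The operator of a pseudo-composition maps the word `1 2 ⋯ n` to the element of the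
pseudo-composition. -/
theorem toTens_markElt {b₀ : ℕ} {bs : List ℕ} (hbs : ∀ b ∈ bs, 1 ≤ b) (h : b₀ + bs.sum = n) :
    toTens 𝕜 (markElt 𝕜 n b₀ bs) =
      peakOp 𝕜 b₀ bs (wordOf 𝕜 (listWord (1 : Perm (Fin n)))) := by
  classical
  ext z
  obtain ⟨z, rfl⟩ := FreeMonoid.ofList.surjective z
  rw [hasKernel_peakOp 𝕜 b₀ bs _ pairwise_listWord_one]
  split_ifs with hz
  · obtain ⟨σ, rfl⟩ := exists_listWord_eq hz
    rw [coeff_toTens, coeff_markElt, convKernel_length 𝕜 (by rw [length_listWord]; omega),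
      veesKernel_eq 𝕜 bs hbs ((nodup_listWord σ).sublist (List.drop_sublist _ _))
        (by rw [List.length_drop, length_listWord]; omega)]
    simp only [forall_mem_peakSet_iff σ hbs h]
    split_ifs <;> simp_all
  · exact coeff_toTens_eq_zero 𝕜 _ hz

/-- The substitution of letters. -/
def substLetters (φ : ℕ → ℕ) : Tens 𝕜 ℕ →ₐ[𝕜] Tens 𝕜 ℕ := tensLift 𝕜 fun x => wordOf 𝕜 [φ x]

theorem substLetters_wordOf (φ : ℕ → ℕ) (w : List ℕ) :
    substLetters 𝕜 φ (wordOf 𝕜 w) = wordOf 𝕜 (w.map φ) := by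
  induction w with
  | nil => simp [wordOf_nil]
  | cons x w ih =>
    rw [wordOf_cons, map_mul, ih, List.map_cons, wordOf_cons 𝕜 (φ x), substLetters,
      tensLift_letter]

variable {𝕜} in
/-- An endomorphism of the tensor algebra which commutes with all substitutions of letters. -/
def IsNatural (f : Tens 𝕜 ℕ →ₗ[𝕜] Tens 𝕜 ℕ) : Prop :=
  ∀ φ w, f (wordOf 𝕜 (w.map φ)) = substLetters 𝕜 φ (f (wordOf 𝕜 w))

variable {𝕜} in
theorem IsNatural.conv {f g : Tens 𝕜 ℕ →ₗ[𝕜] Tens 𝕜 ℕ} (hf : IsNatural f) (hg : IsNatural g) :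
    IsNatural (conv f g) := fun φ w => by
  rw [conv_wordOf, conv_wordOf, map_list_sum, unshuffles_map, List.map_map, List.map_map]
  refine congrArg List.sum (List.map_congr_left fun p _ => ?_)
  simp [hf φ, hg φ]

variable {𝕜} in
theorem IsNatural.comp_proj {f : Tens 𝕜 ℕ →ₗ[𝕜] Tens 𝕜 ℕ} (hf : IsNatural f) (b : ℕ) :
    IsNatural (f ∘ₗ proj 𝕜 b) := fun φ w => by
  rw [LinearMap.comp_apply, LinearMap.comp_apply, proj_wordOf, proj_wordOf, List.length_map]
  split_ifs
  · exact hf φ w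
  · simp

theorem isNatural_id : IsNatural (LinearMap.id : Tens 𝕜 ℕ →ₗ[𝕜] Tens 𝕜 ℕ) := fun φ w =>
  (substLetters_wordOf 𝕜 φ w).symm

theorem isNatural_rev : IsNatural (rev 𝕜 : Tens 𝕜 ℕ →ₗ[𝕜] Tens 𝕜 ℕ) := fun φ w => by
  rw [rev_wordOf, rev_wordOf, substLetters_wordOf, List.map_reverse]

theorem isNatural_veesOp : ∀ bs : List ℕ, IsNatural (veesOp 𝕜 bs)
  | [] => (isNatural_id 𝕜).comp_proj 0
  | b :: bs => (((isNatural_rev 𝕜).conv (isNatural_id 𝕜)).comp_proj b).conv (isNatural_veesOp bs)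

theorem isNatural_peakOp (b₀ : ℕ) (bs : List ℕ) : IsNatural (peakOp 𝕜 b₀ bs) :=
  ((isNatural_id 𝕜).comp_proj b₀).conv (isNatural_veesOp 𝕜 bs)

theorem toTens_single_mul (σ : Perm (Fin n)) (x : MonoidAlgebra 𝕜 (Perm (Fin n))) :
    toTens 𝕜 (MonoidAlgebra.single σ 1 * x) = substLetters 𝕜 (word σ) (toTens 𝕜 x) := by
  induction x using MonoidAlgebra.induction_linear with
  | zero => simp
  | add a b ha hb => simp [mul_add, ha, hb]
  | single τ a =>
    rw [MonoidAlgebra.single_mul_single, toTens_single, toTens_single, map_smul,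
      substLetters_wordOf, listWord_mul, one_mul]

/-- Right multiplication by the element of a pseudo-composition is its operator on words. -/
theorem toTens_mul_markElt {b₀ : ℕ} {bs : List ℕ} (hbs : ∀ b ∈ bs, 1 ≤ b) (h : b₀ + bs.sum = n)
    (z : MonoidAlgebra 𝕜 (Perm (Fin n))) :
    toTens 𝕜 (z * markElt 𝕜 n b₀ bs) = peakOp 𝕜 b₀ bs (toTens 𝕜 z) := by
  induction z using MonoidAlgebra.induction_linear with
  | zero => simp
  | add a b ha hb => simp [add_mul, ha, hb]
  | single σ a =>
    have h1 : (MonoidAlgebra.single σ a : MonoidAlgebra 𝕜 (Perm (Fin n))) =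
        a • MonoidAlgebra.single σ 1 := by simp
    rw [h1, smul_mul_assoc, map_smul, map_smul, map_smul, toTens_single_mul,
      toTens_markElt 𝕜 hbs h, toTens_single, one_smul, ← isNatural_peakOp, ← listWord_mul, mul_one]

/-! ### Spanning -/

variable (n) in
/-- The span of the elements of the pseudo-compositions of `n`. -/
def markSpace : Submodule 𝕜 (MonoidAlgebra 𝕜 (Perm (Fin n))) :=
  Submodule.span 𝕜 {x | ∃ b₀ bs, (∀ b ∈ bs, 1 ≤ b) ∧ b₀ + bs.sum = n ∧ x = markElt 𝕜 n b₀ bs}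

theorem markElt_mem_peakSpace (b₀ : ℕ) (bs : List ℕ) : markElt 𝕜 n b₀ bs ∈ peakSpace 𝕜 n := by
  rw [mem_peakSpace_iff]
  intro σ τ h
  rw [coeff_markElt, coeff_markElt, h]

/-- Every set of positions in `{s, …, n - 1}` with least element `s` is the set of marks of a
pseudo-composition of `n` with first entry `s`. -/
theorem exists_marks_eq {n : ℕ} : ∀ (F : Finset ℕ) (s : ℕ), s ∈ F → F ⊆ Finset.Ico s n →
    ∃ bs : List ℕ, (∀ b ∈ bs, 1 ≤ b) ∧ s + bs.sum = n ∧ marks s bs = F := by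
  intro F
  induction hk : F.card using Nat.strong_induction_on generalizing F with
  | _ k ih =>
    intro s hs hF
    have hsn := Finset.mem_Ico.1 (hF hs)
    rcases (F.erase s).eq_empty_or_nonempty with h0 | h0
    · refine ⟨[n - s], by simp; omega, by simp; omega, ?_⟩
      rw [← Finset.insert_erase hs, h0]
      rfl
    · set m := (F.erase s).min' h0
      have hm := (F.erase s).min'_mem h0
      have hmF := Finset.mem_Ico.1 (hF (Finset.mem_of_mem_erase hm))
      have hms := Finset.ne_of_mem_erase hm
      obtain ⟨bs, h1, h2, h3⟩ := ih _ (by rw [← hk]; exact Finset.card_erase_lt_of_mem hs)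
        (F.erase s) rfl m hm fun x hx => Finset.mem_Ico.2
          ⟨Finset.min'_le _ _ hx, (Finset.mem_Ico.1 (hF (Finset.mem_of_mem_erase hx))).2⟩
      refine ⟨(m - s) :: bs, ?_, ?_, ?_⟩
      · intro b hb
        rcases List.mem_cons.1 hb with rfl | hb
        · omega
        · exact h1 b hb
      · rw [List.sum_cons]; omega
      · rw [marks, Nat.add_sub_cancel' hmF.1, h3, Finset.insert_erase hs]

/-- The weight of a set of positions, for which the elements of pseudo-compositions are
triangular with respect to the elements `P_F`. -/
def posWeight (n : ℕ) (F : Finset ℕ) : ℕ := ∑ i ∈ F, (n - i)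

/-- The map which sends each `j ∈ G` not in `F` to `j - 1` embeds the sparse set `G` in `F`, and
it does not decrease `n - j`. -/
theorem posWeight_lt {F G : Finset ℕ} (hF : F ⊆ Finset.Icc 1 (n - 1)) (hG : IsSparse G)
    (hFG : ∀ j ∈ G, j ∈ F ∨ j - 1 ∈ F) (hne : G ≠ F) (hG1 : ∀ j ∈ G, 1 ≤ j) :
    posWeight n G < posWeight n F := by
  classical
  let φ : ℕ → ℕ := fun j => if j ∈ F then j else j - 1
  have hφF : ∀ j ∈ G, φ j ∈ F := fun j hj => by
    by_cases h : j ∈ F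
    · simp only [φ, if_pos h, h]
    · simp only [φ, if_neg h]
      exact (hFG j hj).resolve_left h
  have hinj : Set.InjOn φ G := by
    intro i hi j hj hij
    have h1 := hG1 i hi
    have h2 := hG1 j hj
    simp only [φ] at hij
    have h3 : j ≠ i + 1 := by rintro rfl; exact hG i hi hj
    have h4 : i ≠ j + 1 := by rintro rfl; exact hG j hj hi
    split_ifs at hij <;> omega
  have himage : posWeight n (G.image φ) = ∑ j ∈ G, (n - φ j) := Finset.sum_image hinj
  have hsub : G.image φ ⊆ F := Finset.image_subset_iff.2 hφF
  have hle : ∀ j ∈ G, n - j ≤ n - φ j := fun j _ => by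
    simp only [φ]; split_ifs <;> omega
  have h1 : posWeight n G ≤ posWeight n (G.image φ) := by
    rw [himage]; exact Finset.sum_le_sum hle
  have h2 : posWeight n (G.image φ) ≤ posWeight n F :=
    Finset.sum_le_sum_of_subset hsub
  by_cases h : ∀ j ∈ G, j ∈ F
  · -- Then `G` is a proper subset of `F`, and every position in `F` has a positive weight.
    obtain ⟨i, hi, hi'⟩ := Finset.exists_of_ssubset (Finset.ssubset_iff_subset_ne.2 ⟨h, hne⟩)
    refine Finset.sum_lt_sum_of_subset h hi hi' ?_ (fun _ _ _ => Nat.zero_le _)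
    have := Finset.mem_Icc.1 (hF hi)
    omega
  · push Not at h
    obtain ⟨j, hj, hj'⟩ := h
    refine lt_of_lt_of_le ?_ h2
    rw [himage]
    refine Finset.sum_lt_sum hle ⟨j, hj, ?_⟩
    have h3 := (hFG j hj).resolve_left hj'
    have := Finset.mem_Icc.1 (hF h3)
    simp only [φ, if_neg hj']
    omega

theorem markElt_eq_sum (b₀ : ℕ) (bs : List ℕ) :
    markElt 𝕜 n b₀ bs = (2 ^ bs.length : 𝕜) • ∑ G ∈ (Finset.univ.image (peakSet (n := n))).filter
      (fun G => ∀ j ∈ G, j ∈ marks b₀ bs ∨ j - 1 ∈ marks b₀ bs), peakSum 𝕜 n G := by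
  classical
  ext σ
  rw [coeff_markElt, MonoidAlgebra.coeff_smul, Finsupp.smul_apply, MonoidAlgebra.coeff_sum,
    Finsupp.finsetSum_apply]
  simp only [coeff_peakSum, Finset.sum_ite_eq, Finset.mem_filter, Finset.mem_image,
    Finset.mem_univ, true_and, exists_apply_eq_apply]
  split_ifs <;> simp

/-- The element of the pseudo-composition with marks `F` is a power of `2` times the sum of `P_F`
and of elements `P_G` of smaller weight. -/
theorem peakSum_mem_markSpace (hn : 2 ≤ n → (2 : 𝕜) ≠ 0) {F : Finset ℕ}
    (hF : F ⊆ Finset.Icc 1 (n - 1)) (hFs : F ∈ Finset.univ.image (peakSet (n := n))) :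
    peakSum 𝕜 n F ∈ markSpace 𝕜 n := by
  classical
  induction hk : posWeight n F using Nat.strong_induction_on generalizing F with
  | _ k ih =>
    obtain ⟨b₀, bs, hbs, hsum, hmarks, h2⟩ : ∃ b₀ bs, (∀ b ∈ bs, 1 ≤ b) ∧ b₀ + bs.sum = n ∧
        marks b₀ bs = F ∧ (2 ^ bs.length : 𝕜) ≠ 0 := by
      rcases F.eq_empty_or_nonempty with rfl | h0
      · exact ⟨n, [], by simp, by simp, rfl, by simp⟩
      · have hm := Finset.mem_Icc.1 (hF (F.min'_mem h0))
        obtain ⟨bs, h1, h2, h3⟩ := exists_marks_eq (n := n) F (F.min' h0) (F.min'_mem h0)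
          fun x hx => by
            have := Finset.mem_Icc.1 (hF hx)
            exact Finset.mem_Ico.2 ⟨Finset.min'_le _ _ hx, by omega⟩
        exact ⟨_, bs, h1, h2, h3, pow_ne_zero _ (hn (by omega))⟩
    have hmem : markElt 𝕜 n b₀ bs ∈ markSpace 𝕜 n :=
      Submodule.subset_span ⟨b₀, bs, hbs, hsum, rfl⟩
    have h3 := Submodule.smul_mem _ (2 ^ bs.length : 𝕜)⁻¹ hmem
    rw [markElt_eq_sum, inv_smul_smul₀ h2, hmarks, ← Finset.add_sum_erase _ _
      (Finset.mem_filter.2 ⟨hFs, fun j hj => .inl hj⟩)] at h3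
    refine (Submodule.add_mem_iff_left _ (Submodule.sum_mem _ fun G hG => ?_)).1 h3
    obtain ⟨hne, hG⟩ := Finset.mem_erase.1 hG
    obtain ⟨hGi, hGF⟩ := Finset.mem_filter.1 hG
    obtain ⟨σ, -, rfl⟩ := Finset.mem_image.1 hGi
    exact ih _ (hk ▸ posWeight_lt hF (isSparse_peakSet σ) hGF hne
      fun j hj => (Finset.mem_Icc.1 (peakSet_subset σ hj)).1) (peakSet_subset σ) hGi rfl

/-- The peak algebra is spanned by the elements of the pseudo-compositions of `n`. -/
theorem peakSpace_eq_markSpace (hn : 2 ≤ n → (2 : 𝕜) ≠ 0) : peakSpace 𝕜 n = markSpace 𝕜 n := by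
  classical
  refine le_antisymm (Submodule.span_le.2 ?_) (Submodule.span_le.2 ?_)
  · rintro _ ⟨F, hF, -, rfl⟩
    by_cases h : F ∈ Finset.univ.image (peakSet (n := n))
    · exact peakSum_mem_markSpace 𝕜 hn hF h
    · have : peakSum 𝕜 n F = 0 := by
        ext σ
        rw [coeff_peakSum, if_neg]
        · simp
        · rintro rfl
          exact h (Finset.mem_image_of_mem _ (Finset.mem_univ σ))
      rw [this]
      exact Submodule.zero_mem _
  · rintro _ ⟨b₀, bs, -, -, rfl⟩
    exact markElt_mem_peakSpace 𝕜 b₀ bs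

end Realization

/-! ### Eigenvalues -/

section Eigenvalues

variable (𝕜 : Type*) [Field 𝕜]

theorem multiset_sum_map_eq_zero {α : Type*} {s : Multiset α} {f : α → 𝕜}
    (h : ∀ a ∈ s, f a = 0) : (s.map f).sum = 0 :=
  Multiset.sum_eq_zero fun x hx => by
    obtain ⟨a, ha, rfl⟩ := Multiset.mem_map.1 hx
    exact h a ha

theorem veeCoeff_eq_zero_of_sum_ne {b : ℕ} {m : Multiset ℕ} (h : m.sum ≠ b) :
    veeCoeff 𝕜 b m = 0 := by
  simp [veeCoeff, projCoeff, h]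

theorem veeCoeff_eq_zero_of_even {b d : ℕ} {m : Multiset ℕ} (hd : Even d) (h : d ∈ m) :
    veeCoeff 𝕜 b m = 0 := by
  rw [veeCoeff, Multiset.prod_eq_zero, mul_zero]
  refine Multiset.mem_map.2 ⟨d, h, ?_⟩
  rw [hd.add_one.neg_one_pow, neg_add_cancel]

theorem veesCoeff_eq_zero_of_sum_ne (bs : List ℕ) {m : Multiset ℕ} (h : m.sum ≠ bs.sum) :
    veesCoeff 𝕜 bs m = 0 := by
  induction bs generalizing m with
  | nil => simpa [veesCoeff, projCoeff] using h
  | cons b bs ih =>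
    refine multiset_sum_map_eq_zero 𝕜 fun p hp => ?_
    rw [Multiset.mem_antidiagonal] at hp
    by_cases h1 : p.1.sum = b
    · rw [ih, mul_zero]
      rintro h2
      rw [← hp, Multiset.sum_add, h1, h2, List.sum_cons] at h
      exact h rfl
    · rw [veeCoeff_eq_zero_of_sum_ne 𝕜 h1, zero_mul]

theorem veesCoeff_eq_zero_of_even (bs : List ℕ) {d : ℕ} {m : Multiset ℕ} (hd : Even d)
    (h0 : d ≠ 0) (h : d ∈ m) : veesCoeff 𝕜 bs m = 0 := by
  induction bs generalizing m with
  | nil =>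
    rw [veesCoeff, projCoeff, if_neg]
    intro h1
    exact h0 (Multiset.sum_eq_zero_iff.1 h1 d h)
  | cons b bs ih =>
    refine multiset_sum_map_eq_zero 𝕜 fun p hp => ?_
    rw [Multiset.mem_antidiagonal] at hp
    rw [← hp, Multiset.mem_add] at h
    rcases h with h | h
    · rw [veeCoeff_eq_zero_of_even 𝕜 hd h, zero_mul]
    · rw [ih h, mul_zero]

/-- The sum of the eigenvalues of `veesOp bs` over all submultisets. -/
def subCoeff (bs : List ℕ) (m : Multiset ℕ) : 𝕜 := (m.powerset.map (veesCoeff 𝕜 bs)).sum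

/-- The submultisets with an even member do not contribute. -/
theorem subCoeff_filter (bs : List ℕ) (m : Multiset ℕ) (h0 : 0 ∉ m) :
    subCoeff 𝕜 bs m = subCoeff 𝕜 bs (m.filter fun d => ¬ Even d) := by
  -- The claim is proved for the sums over all `t ⊆ m` of the eigenvalues at `t + u`.
  have key : ∀ u : Multiset ℕ, (m.powerset.map fun t => veesCoeff 𝕜 bs (t + u)).sum =
      ((m.filter fun d => ¬ Even d).powerset.map fun t => veesCoeff 𝕜 bs (t + u)).sum := by
    induction m using Multiset.induction_on with
    | empty => simp
    | cons d m ih =>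
      intro u
      rw [Multiset.mem_cons, not_or] at h0
      have ih' := ih h0.2
      have h1 : ∀ t : Multiset ℕ, d ::ₘ t + u = t + d ::ₘ u := fun t => by
        rw [Multiset.cons_add, Multiset.add_cons]
      rw [Multiset.powerset_cons, Multiset.map_add, Multiset.sum_add, Multiset.map_map]
      by_cases hd : Even d
      · rw [Multiset.filter_cons_of_neg (p := fun d => ¬ Even d) m (by simpa using hd), ih',
          add_eq_left]
        refine multiset_sum_map_eq_zero 𝕜 fun t _ => ?_
        exact veesCoeff_eq_zero_of_even 𝕜 bs hd (Ne.symm h0.1) (by simp)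
      · rw [Multiset.filter_cons_of_pos (p := fun d => ¬ Even d) m hd, Multiset.powerset_cons,
          Multiset.map_add, Multiset.sum_add, Multiset.map_map]
        simp only [Function.comp_def, h1]
        rw [ih', ih']
  simpa [subCoeff] using key 0

/-- The eigenvalues of the operator of a pseudo-composition depend only on the odd degrees. -/
theorem peakCoeff_eq (b₀ : ℕ) (bs : List ℕ) {m : Multiset ℕ} (h0 : 0 ∉ m) :
    peakCoeff 𝕜 b₀ bs m =
      if m.sum = b₀ + bs.sum then subCoeff 𝕜 bs (m.filter fun d => ¬ Even d) else 0 := by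
  rw [← subCoeff_filter 𝕜 bs m h0, subCoeff, ← Multiset.antidiagonal_map_snd, Multiset.map_map,
    peakCoeff, convCoeff]
  split_ifs with h
  · refine congrArg Multiset.sum (Multiset.map_congr rfl fun p hp => ?_)
    rw [Multiset.mem_antidiagonal] at hp
    rw [← hp, Multiset.sum_add] at h
    rw [projCoeff, Function.comp_apply]
    split_ifs with h1
    · rw [one_mul]
    · rw [zero_mul, veesCoeff_eq_zero_of_sum_ne]
      omega
  · refine multiset_sum_map_eq_zero 𝕜 fun p hp => ?_
    rw [Multiset.mem_antidiagonal] at hp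
    rw [← hp, Multiset.sum_add] at h
    rw [projCoeff]
    split_ifs with h1
    · rw [veesCoeff_eq_zero_of_sum_ne, mul_zero]
      omega
    · rw [zero_mul]

/-- Each of the blocks takes at least one of the degrees. -/
theorem veesCoeff_eq_zero_of_card_lt (bs : List ℕ) (hbs : ∀ b ∈ bs, 1 ≤ b) {m : Multiset ℕ}
    (h : m.card < bs.length) : veesCoeff 𝕜 bs m = 0 := by
  induction bs generalizing m with
  | nil => simp at h
  | cons b bs ih =>
    refine multiset_sum_map_eq_zero 𝕜 fun p hp => ?_
    rw [Multiset.mem_antidiagonal] at hp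
    by_cases h1 : p.1.sum = b
    · have h2 : 0 < p.1.card := by
        rw [Multiset.card_pos]
        rintro h2
        have := hbs b (by simp)
        rw [h2, Multiset.sum_zero] at h1
        omega
      rw [ih (fun b' h => hbs b' (by simp [h])), mul_zero]
      rw [← hp, Multiset.card_add, List.length_cons] at h
      omega
    · rw [veeCoeff_eq_zero_of_sum_ne 𝕜 h1, zero_mul]

theorem sum_antidiagonal_zero (m : Multiset ℕ) :
    (m.antidiagonal.map fun p => if p.1 = 0 then (1 : 𝕜) else 0).sum = 1 := by
  induction m using Multiset.induction_on with
  | empty => simp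
  | cons a m ih =>
    rw [Multiset.antidiagonal_cons, Multiset.map_add, Multiset.sum_add, Multiset.map_map,
      Multiset.map_map]
    simpa [Function.comp_def] using ih

theorem sum_antidiagonal_singleton (b : ℕ) (m : Multiset ℕ) :
    (m.antidiagonal.map fun p => if p.1 = {b} then (1 : 𝕜) else 0).sum = m.count b := by
  induction m using Multiset.induction_on with
  | empty => simp
  | cons a m ih =>
    have h1 : ∀ s : Multiset ℕ, a ::ₘ s = {b} ↔ a = b ∧ s = 0 := fun s => by
      rw [eq_comm, Multiset.singleton_eq_cons_iff, eq_comm]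
    rw [Multiset.antidiagonal_cons, Multiset.map_add, Multiset.sum_add, Multiset.map_map,
      Multiset.map_map]
    simp only [Function.comp_def, Prod.map_fst, id_eq, h1, ih, Multiset.count_cons]
    by_cases hab : a = b
    · simp [hab, sum_antidiagonal_zero]
    · simp [hab, Ne.symm hab]

/-- When there are at most as many degrees as blocks, every block takes a single degree, which is
the length of the block. -/
theorem veesCoeff_cons (b : ℕ) (bs : List ℕ) (hb : 1 ≤ b) (hodd : ¬ Even b)
    (hbs : ∀ b ∈ bs, 1 ≤ b) {m : Multiset ℕ} (h : m.card ≤ bs.length + 1) :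
    veesCoeff 𝕜 (b :: bs) m = m.count b * (2 * veesCoeff 𝕜 bs (m.erase b)) := by
  rw [← sum_antidiagonal_singleton, ← Multiset.sum_map_mul_right]
  refine congrArg Multiset.sum (Multiset.map_congr rfl fun p hp => ?_)
  rw [Multiset.mem_antidiagonal] at hp
  split_ifs with h1
  · have h2 : p.2 = m.erase b := by rw [← hp, h1, Multiset.singleton_add, Multiset.erase_cons_head]
    rw [h2, one_mul, h1]
    congr 1
    rw [Nat.not_even_iff_odd] at hodd
    simp [veeCoeff, projCoeff, hodd.add_one.neg_one_pow, one_add_one_eq_two]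
  · rw [zero_mul]
    by_cases h2 : p.1.sum = b
    · rw [veesCoeff_eq_zero_of_card_lt 𝕜 bs hbs, mul_zero]
      rw [← hp, Multiset.card_add] at h
      by_contra h3
      have h4 : p.1.card ≤ 1 := by omega
      rcases Nat.le_one_iff_eq_zero_or_eq_one.1 h4 with h5 | h5
      · rw [Multiset.card_eq_zero.1 h5, Multiset.sum_zero] at h2
        omega
      · obtain ⟨a, ha⟩ := Multiset.card_eq_one.1 h5
        rw [ha, Multiset.sum_singleton] at h2
        exact h1 (by rw [ha, h2])
    · rw [veeCoeff_eq_zero_of_sum_ne 𝕜 h2, zero_mul]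

/-- Among the multisets with at most as many members as there are blocks, only the multiset of
lengths of the blocks has a nonzero eigenvalue. -/
theorem eq_of_veesCoeff_ne_zero (bs : List ℕ) (hbs : ∀ b ∈ bs, 1 ≤ b ∧ ¬ Even b) {m : Multiset ℕ}
    (h : m.card ≤ bs.length) (hne : veesCoeff 𝕜 bs m ≠ 0) : m = bs := by
  induction bs generalizing m with
  | nil => simpa using h
  | cons b bs ih =>
    have hb := hbs b (by simp)
    have hbs' : ∀ b ∈ bs, 1 ≤ b ∧ ¬ Even b := fun b' h => hbs b' (by simp [h])
    rw [veesCoeff_cons 𝕜 b bs hb.1 hb.2 (fun b h => (hbs' b h).1) h] at hne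
    have h1 : b ∈ m := by
      by_contra h1
      rw [Multiset.count_eq_zero.2 h1] at hne
      simp at hne
    have h2 := ih hbs' (m := m.erase b)
      (by rw [Multiset.card_erase_of_mem h1]; simp at h ⊢; omega)
      (right_ne_zero_of_mul (right_ne_zero_of_mul hne))
    rw [← Multiset.cons_erase h1, h2, Multiset.cons_coe]

theorem veesCoeff_self_ne_zero (bs : List ℕ) (hbs : ∀ b ∈ bs, 1 ≤ b ∧ ¬ Even b)
    (h2 : (2 : 𝕜) ≠ 0) (hn : ∀ k, 1 ≤ k → k ≤ bs.length → (k : 𝕜) ≠ 0) :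
    veesCoeff 𝕜 bs bs ≠ 0 := by
  induction bs with
  | nil => simp [veesCoeff, projCoeff]
  | cons b bs ih =>
    have hb := hbs b (by simp)
    have hbs' : ∀ b ∈ bs, 1 ≤ b ∧ ¬ Even b := fun b' h => hbs b' (by simp [h])
    rw [veesCoeff_cons 𝕜 b bs hb.1 hb.2 (fun b h => (hbs' b h).1) (by simp)]
    refine mul_ne_zero (hn _ ?_ ?_) (mul_ne_zero h2 ?_)
    · rw [Multiset.one_le_count_iff_mem]; simp
    · exact (Multiset.count_le_card _ _).trans (by simp)
    · simpa using ih hbs' fun k h1 h2 => hn k h1 (by rw [List.length_cons]; omega)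

theorem subCoeff_eq (bs : List ℕ) (hbs : ∀ b ∈ bs, 1 ≤ b) {m : Multiset ℕ}
    (h : m.card ≤ bs.length) : subCoeff 𝕜 bs m = veesCoeff 𝕜 bs m := by
  have key : ∀ s : Multiset (Multiset ℕ), (∀ t ∈ s, t ≤ m) →
      (s.map (veesCoeff 𝕜 bs)).sum = s.count m * veesCoeff 𝕜 bs m := by
    intro s
    induction s using Multiset.induction_on with
    | empty => simp
    | cons t s ih =>
      intro hs
      rw [Multiset.map_cons, Multiset.sum_cons, ih fun t ht => hs t (Multiset.mem_cons_of_mem ht),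
        Multiset.count_cons]
      have ht := hs t (Multiset.mem_cons_self t s)
      by_cases htm : m = t
      · rw [if_pos htm, ← htm]; push_cast; ring
      · have hlt := Multiset.card_lt_card (lt_of_le_of_ne ht (Ne.symm htm))
        rw [if_neg htm, veesCoeff_eq_zero_of_card_lt 𝕜 bs hbs (hlt.trans_le h)]
        simp
  have hcount : m.powerset.count m = 1 := by
    clear key h
    have hlt : ∀ s : Multiset ℕ, ∀ t : Multiset ℕ, s.card < t.card → s.powerset.count t = 0 :=
      fun s t hst => Multiset.count_eq_zero.2 fun ht =>
        absurd (Multiset.card_le_card (Multiset.mem_powerset.1 ht)) (not_le.2 hst)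
    induction m using Multiset.induction_on with
    | empty => simp
    | cons a m ih =>
      rw [Multiset.powerset_cons, Multiset.count_add, hlt m _ (by simp),
        Multiset.count_map_eq_count' _ _ (fun s t h => (Multiset.cons_inj_right a).1 h), ih]
  rw [subCoeff, key _ fun t ht => Multiset.mem_powerset.1 ht, hcount]
  simp

end Eigenvalues

/-! ### Multilinear Lie elements -/

noncomputable section Witness

variable (𝕜 : Type*) [Field 𝕜]

/-- The iterated bracket of the letters of a word. -/
def lieWord : List ℕ → Tens 𝕜 ℕ
  | [] => 0
  | [x] => wordOf 𝕜 [x]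
  | x :: y :: u => wordOf 𝕜 [x] * lieWord (y :: u) - lieWord (y :: u) * wordOf 𝕜 [x]

theorem isLie_lieWord : ∀ (u : List ℕ), u ≠ [] → IsLie u.length (lieWord 𝕜 u)
  | [], h => absurd rfl h
  | [x], _ => isLie_letter x
  | x :: y :: u, _ => by
    have := (isLie_letter (𝕜 := 𝕜) x).bracket (isLie_lieWord (y :: u) (by simp))
    rw [add_comm] at this
    exact this

/-- The span of the rearrangements of a word. -/
def permSpan (u : List ℕ) : Submodule 𝕜 (Tens 𝕜 ℕ) :=
  Submodule.span 𝕜 {t | ∃ z : List ℕ, z.Perm u ∧ wordOf 𝕜 z = t}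

variable {𝕜} in
theorem mul_mem_permSpan {u v w : List ℕ} {a b : Tens 𝕜 ℕ} (ha : a ∈ permSpan 𝕜 u)
    (hb : b ∈ permSpan 𝕜 v) (h : (u ++ v).Perm w) : a * b ∈ permSpan 𝕜 w := by
  have := Submodule.mul_mem_mul ha hb
  rw [permSpan, permSpan, Submodule.span_mul_span] at this
  refine Submodule.span_mono ?_ this
  rintro _ ⟨_, ⟨z, h1, rfl⟩, _, ⟨z', h1', rfl⟩, rfl⟩
  exact ⟨z ++ z', (h1.append h1').trans h, wordOf_append 𝕜 z z'⟩

theorem wordOf_mem_permSpan (u : List ℕ) : wordOf 𝕜 u ∈ permSpan 𝕜 u :=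
  Submodule.subset_span ⟨u, .refl u, rfl⟩

theorem lieWord_mem_permSpan : ∀ u : List ℕ, lieWord 𝕜 u ∈ permSpan 𝕜 u
  | [] => Submodule.zero_mem _
  | [x] => wordOf_mem_permSpan 𝕜 [x]
  | x :: y :: u => Submodule.sub_mem _
      (mul_mem_permSpan (wordOf_mem_permSpan 𝕜 [x]) (lieWord_mem_permSpan (y :: u)) (.refl _))
      (mul_mem_permSpan (lieWord_mem_permSpan (y :: u)) (wordOf_mem_permSpan 𝕜 [x])
        (List.perm_append_singleton _ _))

/-- In the bracket of the letter `x` with the bracket of the word `y u`, the word `x y u` can only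
come from the product in which `x` stands first. -/
theorem coeff_lieWord : ∀ u : List ℕ, u ≠ [] → u.Nodup →
    (lieWord 𝕜 u).coeff (FreeMonoid.ofList u) = 1
  | [], h, _ => absurd rfl h
  | [x], _, _ => by rw [lieWord, coeff_wordOf, if_pos rfl]
  | x :: y :: u, _, h => by
    have ih := coeff_lieWord (y :: u) (by simp) (List.nodup_cons.1 h).2
    have h1 : (lieWord 𝕜 (y :: u) * wordOf 𝕜 [x]).coeff (FreeMonoid.ofList (x :: y :: u)) = 0 := by
      refine MonoidAlgebra.coeff_mul_single_of_forall_mul_ne _ _ fun d hd => ?_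
      -- Otherwise the word `y u` would end with the letter `x`.
      have h2 : FreeMonoid.toList d ++ [x] = x :: y :: u := congrArg FreeMonoid.toList hd
      have h3 := congrArg List.getLast? h2
      rw [List.getLast?_append_of_ne_nil _ (by simp), List.getLast?_cons_cons] at h3
      exact (List.nodup_cons.1 h).1 (List.mem_of_getLast? (h3.symm.trans (by simp)))
    have h2 : (wordOf 𝕜 [x] * lieWord 𝕜 (y :: u)).coeff (FreeMonoid.ofList (x :: y :: u)) = 1 := by
      rw [coeff_mul_splits, Finset.sum_eq_single 1]
      · rw [coeff_wordOf]; simpa using ih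
      · intro i _ hi
        rw [coeff_wordOf, if_neg, zero_mul]
        intro h3
        have := congrArg List.length h3
        simp only [List.length_take, List.length_cons, List.length_nil] at this
        omega
      · intro h3
        simp at h3
    rw [lieWord, MonoidAlgebra.coeff_sub, Finsupp.sub_apply, h1, h2, sub_zero]

/-- The span of the words with letters greater than `s`. -/
def upSpan (s : ℕ) : Submodule 𝕜 (Tens 𝕜 ℕ) :=
  Submodule.span 𝕜 {t | ∃ z : List ℕ, (∀ x ∈ z, s < x) ∧ wordOf 𝕜 z = t}

variable {𝕜} in
theorem mul_mem_upSpan {s : ℕ} {a b : Tens 𝕜 ℕ} (ha : a ∈ upSpan 𝕜 s)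
    (hb : b ∈ upSpan 𝕜 s) : a * b ∈ upSpan 𝕜 s := by
  have := Submodule.mul_mem_mul ha hb
  rw [upSpan, Submodule.span_mul_span] at this
  refine Submodule.span_mono ?_ this
  rintro _ ⟨_, ⟨z, h1, rfl⟩, _, ⟨z', h1', rfl⟩, rfl⟩
  exact ⟨z ++ z', fun x hx => (List.mem_append.1 hx).elim (h1 x) (h1' x), wordOf_append 𝕜 z z'⟩

variable {𝕜} in
theorem val_mem_upSpan {s : ℕ} {ℓ : List (ℕ × Tens 𝕜 ℕ)} (h : ∀ p ∈ ℓ, p.2 ∈ upSpan 𝕜 s) :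
    val ℓ ∈ upSpan 𝕜 s := by
  induction ℓ with
  | nil => exact Submodule.subset_span ⟨[], by simp, rfl⟩
  | cons p ℓ ih =>
    rw [val_cons]
    exact mul_mem_upSpan (h p (by simp)) (ih fun q hq => h q (List.mem_cons_of_mem _ hq))

variable {𝕜} in
theorem coeff_eq_zero_of_mem_upSpan {s : ℕ} {t : Tens 𝕜 ℕ} (ht : t ∈ upSpan 𝕜 s) {u : List ℕ}
    {x : ℕ} (hx : x ∈ u) (hxs : x ≤ s) : t.coeff (FreeMonoid.ofList u) = 0 := by
  induction ht using Submodule.span_induction with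
  | mem t ht =>
    obtain ⟨z, hz, rfl⟩ := ht
    rw [coeff_wordOf, if_neg]
    rintro rfl
    exact absurd (hz x hx) (not_lt.2 hxs)
  | zero => simp
  | add a b _ _ ha hb => simp [ha, hb]
  | smul a b _ hb => simp [hb]

/-- The words of consecutive letters of the lengths `ds`, starting after the letter `s`. -/
def blocks : ℕ → List ℕ → List (List ℕ)
  | _, [] => []
  | s, d :: ds => List.range' (s + 1) d :: blocks (s + d) ds

/-- The Lie elements of the degrees `ds` in consecutive letters, starting after the letter `s`. -/
def lieList (s : ℕ) (ds : List ℕ) : List (ℕ × Tens 𝕜 ℕ) :=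
  (blocks s ds).map fun u => (u.length, lieWord 𝕜 u)

theorem lieList_cons (s d : ℕ) (ds : List ℕ) :
    lieList 𝕜 s (d :: ds) = (d, lieWord 𝕜 (List.range' (s + 1) d)) :: lieList 𝕜 (s + d) ds := by
  simp [lieList, blocks]

theorem isLieList_lieList {ds : List ℕ} (hds : ∀ d ∈ ds, 1 ≤ d) (s : ℕ) :
    IsLieList (lieList 𝕜 s ds) := by
  induction ds generalizing s with
  | nil => simp [lieList, blocks, IsLieList]
  | cons d ds ih =>
    rw [lieList_cons, isLieList_cons]
    refine ⟨?_, ih (fun d h => hds d (by simp [h])) _⟩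
    have hd := hds d (by simp)
    have := isLie_lieWord 𝕜 (List.range' (s + 1) d) (by simp; omega)
    rwa [List.length_range'] at this

theorem degs_lieList (s : ℕ) (ds : List ℕ) : degs (lieList 𝕜 s ds) = ds := by
  induction ds generalizing s with
  | nil => rfl
  | cons d ds ih => rw [lieList_cons, degs_cons, ih]; rfl

theorem val_lieList_mem_permSpan (s : ℕ) (ds : List ℕ) :
    val (lieList 𝕜 s ds) ∈ permSpan 𝕜 (List.range' (s + 1) ds.sum) := by
  induction ds generalizing s with
  | nil => exact wordOf_mem_permSpan 𝕜 []
  | cons d ds ih =>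
    rw [lieList_cons, val_cons]
    refine mul_mem_permSpan (lieWord_mem_permSpan 𝕜 _) (ih _) ?_
    rw [List.sum_cons, show s + d + 1 = s + 1 + d by omega, List.range'_append_1]

theorem lieList_mem_upSpan (s : ℕ) (ds : List ℕ) :
    ∀ p ∈ lieList 𝕜 s ds, p.2 ∈ upSpan 𝕜 s := by
  induction ds generalizing s with
  | nil => simp [lieList, blocks]
  | cons d ds ih =>
    intro p hp
    rw [lieList_cons, List.mem_cons] at hp
    rcases hp with rfl | hp
    · refine Submodule.span_mono ?_ (lieWord_mem_permSpan 𝕜 _)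
      rintro _ ⟨z, hz, rfl⟩
      refine ⟨z, fun x hx => ?_, rfl⟩
      have := List.mem_range'_1.1 (hz.mem_iff.1 hx)
      omega
    · refine Submodule.span_mono ?_ (ih _ p hp)
      rintro _ ⟨z, hz, rfl⟩
      exact ⟨z, fun x hx => by have := hz x hx; omega, rfl⟩

/-- The coefficient of the word `u`, as a scalar endomorphism of the tensor algebra. -/
def coeffOp (u : List ℕ) : Tens 𝕜 ℕ →ₗ[𝕜] Tens 𝕜 ℕ :=
  (Algebra.linearMap 𝕜 (Tens 𝕜 ℕ)) ∘ₗ Finsupp.lapply (FreeMonoid.ofList u) ∘ₗ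
    (MonoidAlgebra.coeffLinearEquiv 𝕜).toLinearMap

theorem coeffOp_apply (u : List ℕ) (t : Tens 𝕜 ℕ) :
    coeffOp 𝕜 u t = algebraMap 𝕜 (Tens 𝕜 ℕ) (t.coeff (FreeMonoid.ofList u)) := rfl

/-- The convolution of the coefficients of given words, which is the coefficient of their tensor
product in the iterated coproduct, or the pairing with their shuffle product. -/
def coeffsOp : List (List ℕ) → (Tens 𝕜 ℕ →ₗ[𝕜] Tens 𝕜 ℕ)
  | [] => coeffOp 𝕜 []
  | u :: us => conv (coeffOp 𝕜 u) (coeffsOp us)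

theorem coeffOp_one {u : List ℕ} (h : u ≠ []) : coeffOp 𝕜 u 1 = 0 := by
  rw [coeffOp_apply, ← wordOf_nil, coeff_wordOf, if_neg h, map_zero]

/-- A convolution of more coefficients of nonempty words than there are Lie factors vanishes: one
of the words is paired with an empty product. -/
theorem coeffsOp_val_eq_zero {us : List (List ℕ)} (hus : ∀ u ∈ us, u ≠ [])
    {ℓ : List (ℕ × Tens 𝕜 ℕ)} (hℓ : IsLieList ℓ) (h : ℓ.length < us.length) :
    coeffsOp 𝕜 us (val ℓ) = 0 := by
  induction us generalizing ℓ with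
  | nil => simp at h
  | cons u us ih =>
    rw [coeffsOp, conv_val _ _ hℓ]
    refine List.sum_eq_zero fun x hx => ?_
    obtain ⟨p, hp, rfl⟩ := List.mem_map.1 hx
    have hperm := perm_of_mem_unshuffles hp
    have hlie := isLieList_append.1 (hℓ.perm hperm.symm)
    have hlen := hperm.length_eq
    rw [List.length_append] at hlen
    rw [List.length_cons] at h
    rcases List.eq_nil_or_concat p.1 with h1 | ⟨q, a, h1⟩
    · rw [h1, val_nil, coeffOp_one 𝕜 (hus u (by simp)), zero_mul]
    · rw [ih (fun u h => hus u (by simp [h])) hlie.2, mul_zero]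
      rw [h1] at hlen
      simp at hlen
      omega

/-- If only the splittings with the whole list in the second part contribute, then there is only
one contribution. -/
theorem sum_unshuffles_eq {α R : Type*} [AddCommMonoid R] (l : List α) (h : List α × List α → R)
    (h0 : ∀ p ∈ unshuffles l, p.2.length < l.length → h p = 0) :
    ((unshuffles l).map h).sum = h ([], l) := by
  induction l generalizing h with
  | nil => simp [unshuffles]
  | cons a l ih =>
    rw [unshuffles, List.map_append, List.sum_append, List.map_map, List.map_map,
      ih (h ∘ fun p => (p.1, a :: p.2)) fun p hp hlt =>
        h0 _ (List.mem_append_right _ (List.mem_map_of_mem hp)) (by simpa using hlt)]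
    rw [List.sum_eq_zero, zero_add]
    · rfl
    · intro x hx
      obtain ⟨p, hp, rfl⟩ := List.mem_map.1 hx
      exact h0 (a :: p.1, p.2) (List.mem_append_left _
        (List.mem_map_of_mem (f := fun p : List α × List α => (a :: p.1, p.2)) hp))
        (Nat.lt_succ_of_le (sublist_of_mem_unshuffles hp).2.length_le)

theorem blocks_ne_nil {ds : List ℕ} (hds : ∀ d ∈ ds, 1 ≤ d) (s : ℕ) :
    ∀ u ∈ blocks s ds, u ≠ [] := by
  induction ds generalizing s with
  | nil => simp [blocks]
  | cons d ds ih =>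
    intro u hu
    rcases List.mem_cons.1 hu with rfl | hu
    · have := hds d (by simp)
      simp; omega
    · exact ih (fun d h => hds d (by simp [h])) _ u hu

/-- The product of the iterated brackets of the blocks has coefficient `1` at the blocks: the
first letter of a block occurs in its own bracket only. -/
theorem coeffsOp_lieList {ds : List ℕ} (hds : ∀ d ∈ ds, 1 ≤ d) (s : ℕ) :
    coeffsOp 𝕜 (blocks s ds) (val (lieList 𝕜 s ds)) = 1 := by
  induction ds generalizing s with
  | nil =>
    change coeffOp 𝕜 [] (wordOf 𝕜 []) = 1
    rw [coeffOp_apply, coeff_wordOf, if_pos rfl, map_one]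
  | cons d ds ih =>
    have hds' : ∀ d ∈ ds, 1 ≤ d := fun d h => hds d (by simp [h])
    have hd := hds d (by simp)
    have hlie := isLieList_lieList 𝕜 hds s
    rw [lieList_cons] at hlie ⊢
    rw [blocks, coeffsOp, conv_val _ _ hlie, unshuffles, List.map_append, List.sum_append,
      List.map_map, List.map_map]
    have h2 : (List.map ((fun p : List (ℕ × Tens 𝕜 ℕ) × List (ℕ × Tens 𝕜 ℕ) =>
        coeffOp 𝕜 (List.range' (s + 1) d) (val p.1) *
          coeffsOp 𝕜 (blocks (s + d) ds) (val p.2)) ∘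
        fun p => (p.1, (d, lieWord 𝕜 (List.range' (s + 1) d)) :: p.2))
        (unshuffles (lieList 𝕜 (s + d) ds))).sum = 0 := by
      refine List.sum_eq_zero fun x hx => ?_
      obtain ⟨p, hp, rfl⟩ := List.mem_map.1 hx
      have h3 : val p.1 ∈ upSpan 𝕜 (s + d) := val_mem_upSpan fun q hq =>
        lieList_mem_upSpan 𝕜 _ ds q ((sublist_of_mem_unshuffles hp).1.subset hq)
      simp only [Function.comp_apply]
      rw [coeffOp_apply, coeff_eq_zero_of_mem_upSpan h3 (x := s + 1), map_zero, zero_mul]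
      · rw [List.mem_range'_1]; omega
      · omega
    have hlie' := (isLieList_cons.1 hlie).2
    rw [h2, add_zero]
    rw [sum_unshuffles_eq]
    · have hnd : (List.range' (s + 1) d).Nodup := List.nodup_range'
      simp only [Function.comp_apply, val_cons, val_nil, mul_one]
      rw [ih hds', mul_one, coeffOp_apply, coeff_lieWord 𝕜 _ (by simp; omega) hnd, map_one]
    · intro p hp hlt
      simp only [Function.comp_apply]
      rw [coeffsOp_val_eq_zero 𝕜 (blocks_ne_nil hds' _)
        (fun q hq => hlie' q ((sublist_of_mem_unshuffles hp).2.subset hq))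
        (by simpa [lieList] using hlt), mul_zero]

end Witness

noncomputable section Characters

variable {𝕜 : Type*} [Field 𝕜] {n : ℕ}

/-! ### Characters of the peak algebra -/

/-- Right multiplication by `x` is realized on words by the triangular endomorphism `g`, with
eigenvalues `c`, which on multisets of positive degrees are supported on those with sum `n` and
depend on the odd degrees only. -/
structure IsRealizedBy (x : MonoidAlgebra 𝕜 (Perm (Fin n))) (g : Tens 𝕜 ℕ →ₗ[𝕜] Tens 𝕜 ℕ)
    (c : Multiset ℕ → 𝕜) : Prop where
  toTens_mul : ∀ z, toTens 𝕜 (z * x) = g (toTens 𝕜 z)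
  triangular : Triangular g c
  eq_zero : ∀ m : Multiset ℕ, 0 ∉ m → m.sum ≠ n → c m = 0
  eq_of_odd : ∀ m m' : Multiset ℕ, 0 ∉ m → 0 ∉ m' → m.sum = n → m'.sum = n →
    (m.filter fun d => ¬ Even d) = (m'.filter fun d => ¬ Even d) → c m = c m'

theorem isRealizedBy_markElt {b₀ : ℕ} {bs : List ℕ} (hbs : ∀ b ∈ bs, 1 ≤ b)
    (h : b₀ + bs.sum = n) :
    IsRealizedBy (markElt 𝕜 n b₀ bs) (peakOp 𝕜 b₀ bs) (peakCoeff 𝕜 b₀ bs) where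
  toTens_mul := toTens_mul_markElt 𝕜 hbs h
  triangular := triangular_peakOp 𝕜 b₀ bs
  eq_zero m h0 hm := by rw [peakCoeff_eq 𝕜 b₀ bs h0, if_neg (by omega)]
  eq_of_odd m m' h0 h0' hm hm' hodd := by
    rw [peakCoeff_eq 𝕜 b₀ bs h0, peakCoeff_eq 𝕜 b₀ bs h0', if_pos (by omega), if_pos (by omega),
      hodd]

theorem IsRealizedBy.mul {x y : MonoidAlgebra 𝕜 (Perm (Fin n))} {g g' : Tens 𝕜 ℕ →ₗ[𝕜] Tens 𝕜 ℕ}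
    {c c' : Multiset ℕ → 𝕜} (h : IsRealizedBy x g c) (h' : IsRealizedBy y g' c') :
    IsRealizedBy (x * y) (g' ∘ₗ g) (c' * c) where
  toTens_mul z := by rw [← mul_assoc, h'.toTens_mul, h.toTens_mul]; rfl
  triangular := h'.triangular.comp h.triangular
  eq_zero m h0 hm := by simp [h.eq_zero m h0 hm]
  eq_of_odd m m' h0 h0' hm hm' hodd := by
    simp [h.eq_of_odd m m' h0 h0' hm hm' hodd, h'.eq_of_odd m m' h0 h0' hm hm' hodd]

theorem exists_isRealizedBy (hn : 2 ≤ n → (2 : 𝕜) ≠ 0) {x : MonoidAlgebra 𝕜 (Perm (Fin n))}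
    (hx : x ∈ peakSpace 𝕜 n) : ∃ g c, IsRealizedBy x g c := by
  rw [peakSpace_eq_markSpace 𝕜 hn] at hx
  induction hx using Submodule.span_induction with
  | mem x hx =>
    obtain ⟨b₀, bs, h1, h2, rfl⟩ := hx
    exact ⟨_, _, isRealizedBy_markElt h1 h2⟩
  | zero => exact ⟨0, 0, fun z => by simp, Triangular.zero, by simp, by simp⟩
  | add x y _ _ hx hy =>
    obtain ⟨g, c, h⟩ := hx
    obtain ⟨g', c', h'⟩ := hy
    refine ⟨g + g', c + c', fun z => ?_, h.triangular.add h'.triangular, fun m h0 hm => ?_,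
      fun m m' h0 h0' hm hm' hodd => ?_⟩
    · rw [mul_add, map_add, h.toTens_mul, h'.toTens_mul]; rfl
    · simp [h.eq_zero m h0 hm, h'.eq_zero m h0 hm]
    · simp [h.eq_of_odd m m' h0 h0' hm hm' hodd, h'.eq_of_odd m m' h0 h0' hm hm' hodd]
  | smul a x _ hx =>
    obtain ⟨g, c, h⟩ := hx
    refine ⟨a • g, a • c, fun z => ?_, h.triangular.smul a, fun m h0 hm => ?_,
      fun m m' h0 h0' hm hm' hodd => ?_⟩
    · rw [mul_smul_comm, map_smul, h.toTens_mul]; rfl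
    · simp [h.eq_zero m h0 hm]
    · simp [h.eq_of_odd m m' h0 h0' hm hm' hodd]

theorem permSpan_le_range_toTens :
    permSpan 𝕜 (listWord (1 : Perm (Fin n))) ≤ LinearMap.range (toTens 𝕜 (n := n)) := by
  refine Submodule.span_le.2 ?_
  rintro _ ⟨z, hz, rfl⟩
  obtain ⟨σ, rfl⟩ := exists_listWord_eq hz
  exact ⟨MonoidAlgebra.single σ 1, by rw [toTens_single, one_smul]⟩

/-- The eigenvalues at a given multiset of degrees are a linear function of the element of the
peak algebra. The function is a matrix coefficient, for a product of multilinear Lie elements of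
these degrees which is not a combination of products of fewer Lie elements. -/
theorem exists_eigenvalue_functional {m : Multiset ℕ} (h0 : 0 ∉ m) (hm : m.sum = n) :
    ∃ φ : MonoidAlgebra 𝕜 (Perm (Fin n)) →ₗ[𝕜] 𝕜,
      φ 1 = 1 ∧ ∀ x g c, IsRealizedBy x g c → φ x = c m := by
  have hds : ∀ d ∈ m.toList, 1 ≤ d := fun d hd => by
    rw [Multiset.mem_toList] at hd
    exact Nat.one_le_iff_ne_zero.2 fun h => h0 (h ▸ hd)
  have hsum : m.toList.sum = n := by rw [Multiset.sum_toList, hm]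
  set ℓ := lieList 𝕜 0 m.toList with hℓ
  have hlie : IsLieList ℓ := isLieList_lieList 𝕜 hds 0
  obtain ⟨z, hz⟩ : val ℓ ∈ LinearMap.range (toTens 𝕜 (n := n)) := by
    refine permSpan_le_range_toTens ?_
    have := val_lieList_mem_permSpan 𝕜 0 m.toList
    rwa [hsum, show List.range' (0 + 1) n = listWord (1 : Perm (Fin n)) by
      rw [listWord_one, List.range'_eq_map_range]; simp [add_comm]] at this
  let ψ : Tens 𝕜 ℕ →ₗ[𝕜] 𝕜 := Finsupp.lapply (FreeMonoid.ofList []) ∘ₗ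
    (MonoidAlgebra.coeffLinearEquiv 𝕜).toLinearMap ∘ₗ coeffsOp 𝕜 (blocks 0 m.toList)
  have hψ1 : ψ (val ℓ) = 1 := by
    change ((coeffsOp 𝕜 (blocks 0 m.toList)) (val ℓ)).coeff (FreeMonoid.ofList []) = 1
    rw [hℓ, coeffsOp_lieList 𝕜 hds 0, ← wordOf_nil, coeff_wordOf, if_pos rfl]
  have hψ0 : ∀ t ∈ lieFil 𝕜 ℕ ℓ.length, ψ t = 0 := by
    have : lieFil 𝕜 ℕ ℓ.length ≤ LinearMap.ker ψ := by
      refine Submodule.span_le.2 ?_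
      rintro _ ⟨ℓ', h1, h2, rfl⟩
      change ((coeffsOp 𝕜 (blocks 0 m.toList)) (val ℓ')).coeff (FreeMonoid.ofList []) = 0
      rw [coeffsOp_val_eq_zero 𝕜 (blocks_ne_nil hds 0) h1 (by simpa [hℓ, lieList] using h2)]
      rfl
    exact fun t ht => this ht
  clear_value ψ
  refine ⟨ψ ∘ₗ toTens 𝕜 ∘ₗ LinearMap.mulLeft 𝕜 z, ?_, fun x g c h => ?_⟩
  · rw [LinearMap.comp_apply, LinearMap.comp_apply, LinearMap.mulLeft_apply, mul_one, hz, hψ1]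
  have h1 := hψ0 _ (h.triangular ℓ hlie)
  rw [map_sub, map_smul, hψ1, sub_eq_zero, smul_eq_mul, mul_one, hℓ, degs_lieList,
    Multiset.coe_toList, ← hℓ, ← hz, ← h.toTens_mul] at h1
  exact h1

/-- An element of the peak algebra with zero eigenvalues is nilpotent. -/
theorem IsRealizedBy.pow_eq_zero {x : MonoidAlgebra 𝕜 (Perm (Fin n))}
    {g : Tens 𝕜 ℕ →ₗ[𝕜] Tens 𝕜 ℕ} {c : Multiset ℕ → 𝕜} (h : IsRealizedBy x g c)
    (hc : ∀ m : Multiset ℕ, 0 ∉ m → c m = 0) : x ^ (n + 1) = 0 := by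
  have h1 : ∀ j t, t ∈ lieFil 𝕜 ℕ (j + 1) → g t ∈ lieFil 𝕜 ℕ j := by
    intro j
    have : lieFil 𝕜 ℕ (j + 1) ≤ (lieFil 𝕜 ℕ j).comap g := by
      refine Submodule.span_le.2 ?_
      rintro _ ⟨ℓ, hℓ, hlen, rfl⟩
      have h2 := h.triangular ℓ hℓ
      have h3 : 0 ∉ degs ℓ := fun h0 => by
        obtain ⟨p, hp, hp0⟩ := List.mem_map.1 (Multiset.mem_coe.1 h0)
        have := (hℓ p hp).pos
        omega
      rw [hc _ h3, zero_smul, sub_zero] at h2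
      exact lieFil_mono (by omega) h2
    exact fun t ht => this ht
  have h2 : ∀ k, k ≤ n + 1 → toTens 𝕜 (x ^ k) ∈ lieFil 𝕜 ℕ (n + 1 - k) := by
    intro k
    induction k with
    | zero =>
      intro _
      rw [pow_zero, MonoidAlgebra.one_def, toTens_single, one_smul, ← val_letters]
      exact val_mem_lieFil (isLieList_letters _) (by simp [letters, length_listWord])
    | succ k ih =>
      intro hk
      rw [pow_succ, h.toTens_mul]
      refine h1 _ _ ?_
      rw [show n + 1 - (k + 1) + 1 = n + 1 - k by omega]
      exact ih (by omega)
  have h3 := h2 (n + 1) le_rfl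
  have h4 : lieFil 𝕜 ℕ 0 = ⊥ := by simp [lieFil]
  rw [Nat.sub_self, h4, Submodule.mem_bot] at h3
  exact toTens_injective 𝕜 (h3.trans (map_zero _).symm)

theorem parts_zero_notMem (p : n.Partition) : 0 ∉ p.parts := fun h =>
  absurd (p.parts_pos h) (lt_irrefl 0)

/-- The character of the peak algebra attached to a partition of `n`, which maps an element to
its eigenvalue on the products of Lie elements whose degrees are the parts. -/
theorem exists_character (hn : 2 ≤ n → (2 : 𝕜) ≠ 0) (p : n.Partition) :
    ∃ χ : peakAlgebra 𝕜 n →ₐ[𝕜] 𝕜, ∀ (x : peakAlgebra 𝕜 n) g c,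
      IsRealizedBy (x : MonoidAlgebra 𝕜 (Perm (Fin n))) g c → χ x = c p.parts := by
  obtain ⟨φ, hone, hφ⟩ :=
    exists_eigenvalue_functional (𝕜 := 𝕜) (parts_zero_notMem p) p.parts_sum
  refine ⟨AlgHom.ofLinearMap (φ ∘ₗ (peakAlgebra 𝕜 n).val.toLinearMap) hone fun x y => ?_,
    fun x g c h => hφ _ g c h⟩
  obtain ⟨g, c, h⟩ := exists_isRealizedBy hn ((mem_peakAlgebra 𝕜).1 x.2)
  obtain ⟨g', c', h'⟩ := exists_isRealizedBy hn ((mem_peakAlgebra 𝕜).1 y.2)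
  change φ (x * y : MonoidAlgebra 𝕜 (Perm (Fin n))) = φ x * φ y
  rw [hφ _ _ _ (h.mul h'), hφ _ _ _ h, hφ _ _ _ h', Pi.mul_apply, mul_comm]

/-- The character of the peak algebra attached to a partition of `n`. -/
def character (hn : 2 ≤ n → (2 : 𝕜) ≠ 0) (p : n.Partition) : peakAlgebra 𝕜 n →ₐ[𝕜] 𝕜 :=
  (exists_character hn p).choose

theorem character_apply (hn : 2 ≤ n → (2 : 𝕜) ≠ 0) (p : n.Partition) {x : peakAlgebra 𝕜 n}
    {g : Tens 𝕜 ℕ →ₗ[𝕜] Tens 𝕜 ℕ} {c : Multiset ℕ → 𝕜}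
    (h : IsRealizedBy (x : MonoidAlgebra 𝕜 (Perm (Fin n))) g c) :
    character hn p x = c p.parts :=
  (exists_character hn p).choose_spec x g c h

/-! ### Almost-odd partitions -/

theorem filter_even_eq {p : n.Partition} (hp : p ∈ almostOddPartitions n) :
    p.parts.filter Even = 0 ∨ ∃ e, 0 < e ∧ p.parts.filter Even = {e} := by
  have h := (Finset.mem_filter.1 hp).2
  rcases Nat.le_one_iff_eq_zero_or_eq_one.1 h with h | h
  · exact .inl (Multiset.card_eq_zero.1 h)
  · obtain ⟨e, he⟩ := Multiset.card_eq_one.1 h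
    refine .inr ⟨e, p.parts_pos (Multiset.mem_of_mem_filter (p := Even) ?_), he⟩
    rw [he]
    exact Multiset.mem_singleton_self e

theorem sum_filter_even_add (p : n.Partition) :
    (p.parts.filter Even).sum + (p.parts.filter fun d => ¬ Even d).sum = n := by
  rw [← Multiset.sum_add, Multiset.filter_add_not, p.parts_sum]

/-- An almost-odd partition of `n` is determined by its odd parts. -/
theorem almostOdd_ext {p q : n.Partition} (hp : p ∈ almostOddPartitions n)
    (hq : q ∈ almostOddPartitions n)
    (h : (p.parts.filter fun d => ¬ Even d) = q.parts.filter fun d => ¬ Even d) : p = q := by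
  have h1 : p.parts.filter Even = q.parts.filter Even := by
    have hp' := sum_filter_even_add p
    have hq' := sum_filter_even_add q
    rw [h] at hp'
    rcases filter_even_eq hp with e | ⟨a, ha, e⟩ <;>
      rcases filter_even_eq hq with e' | ⟨b, hb, e'⟩ <;>
        rw [e] at hp' ⊢ <;> rw [e'] at hq' ⊢ <;> simp at hp' hq' ⊢ <;> omega
  refine Nat.Partition.ext ?_
  rw [← Multiset.filter_add_not Even p.parts, ← Multiset.filter_add_not Even q.parts, h1, h]

theorem exists_almostOdd {o : Multiset ℕ} {e : ℕ} (ho : ∀ d ∈ o, ¬ Even d) (he : Even e)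
    (h : e + o.sum = n) : ∃ p ∈ almostOddPartitions n, (p.parts.filter fun d => ¬ Even d) = o ∧
      (p.parts.filter Even).sum = e := by
  have ho1 : o.filter Even = 0 := Multiset.filter_eq_nil.2 ho
  have ho2 : (o.filter fun d => ¬ Even d) = o := Multiset.filter_eq_self.2 ho
  have hpos : ∀ {d}, d ∈ o → 0 < d := fun {d} hd =>
    Nat.pos_of_ne_zero fun h0 => ho d hd (h0 ▸ Even.zero)
  rcases Nat.eq_zero_or_pos e with rfl | he0
  · refine ⟨⟨o, hpos, by omega⟩, Finset.mem_filter.2 ⟨Finset.mem_univ _, ?_⟩, ho2, ?_⟩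
    · simp [ho1]
    · simp [ho1]
  · refine ⟨⟨e ::ₘ o, fun {d} hd => ?_, by rw [Multiset.sum_cons, h]⟩,
      Finset.mem_filter.2 ⟨Finset.mem_univ _, ?_⟩, ?_, ?_⟩
    · rcases Multiset.mem_cons.1 hd with rfl | hd
      · exact he0
      · exact hpos hd
    · simp [he, ho1]
    · rw [Multiset.filter_cons_of_neg (p := fun d => ¬ Even d) o (by simpa using he), ho2]
    · simp [he, ho1]

theorem even_sum_filter_even (m : Multiset ℕ) : Even (m.filter Even).sum :=
  Multiset.sum_induction Even _ (fun _ _ => Even.add) Even.zero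
    fun _ h => (Multiset.mem_filter.1 h).2

theorem card_almostOdd (n : ℕ) : (almostOddPartitions n).card =
    ∑ j ∈ Finset.range (n / 2 + 1), (Nat.Partition.odds (n - 2 * j)).card := by
  rw [Finset.card_eq_sum_card_fiberwise (t := Finset.range (n / 2 + 1))
    (f := fun p => (p.parts.filter Even).sum / 2)]
  · refine Finset.sum_congr rfl fun j hj => ?_
    rw [Finset.mem_range] at hj
    have key : ∀ p ∈ (almostOddPartitions n).filter fun p => (p.parts.filter Even).sum / 2 = j,
        (p.parts.filter fun d => ¬ Even d).sum = n - 2 * j := fun p hp => by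
      have h1 := (Finset.mem_filter.1 hp).2
      have h2 := sum_filter_even_add p
      obtain ⟨k, hk⟩ := even_sum_filter_even p.parts
      omega
    refine Finset.card_bij (fun p hp => ⟨p.parts.filter fun d => ¬ Even d,
      fun {d} hd => p.parts_pos (Multiset.mem_of_mem_filter hd), key p hp⟩) ?_ ?_ ?_
    · intro p hp
      exact Finset.mem_filter.2 ⟨Finset.mem_univ _, fun d hd => (Multiset.mem_filter.1 hd).2⟩
    · intro p hp q hq h
      exact almostOdd_ext (Finset.mem_filter.1 hp).1 (Finset.mem_filter.1 hq).1
        (congrArg Nat.Partition.parts h)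
    · intro q hq
      obtain ⟨p, h1, h2, h3⟩ := exists_almostOdd (n := n) (e := 2 * j) (o := q.parts)
        (Finset.mem_filter.1 hq).2 (even_two_mul j) (by rw [q.parts_sum]; omega)
      exact ⟨p, Finset.mem_filter.2 ⟨h1, by rw [h3]; omega⟩, Nat.Partition.ext h2⟩
  · intro p _
    have := sum_filter_even_add p
    rw [Finset.mem_coe, Finset.mem_range]
    change (p.parts.filter Even).sum / 2 < n / 2 + 1
    omega

/-! ### Separation of the characters -/

/-- The characters attached to two different almost-odd partitions `p` and `q`, where `q` has at
least as many odd parts as `p`, differ at the element of the pseudo-composition formed by the sum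
of the even parts of `q` and its odd parts: the eigenvalue at `p` is zero, and the one at `q` is
not. -/
theorem character_separates (hn : (n.factorial : 𝕜) ≠ 0) (h2 : 2 ≤ n → (2 : 𝕜) ≠ 0)
    {p q : n.Partition} (hp : p ∈ almostOddPartitions n) (hq : q ∈ almostOddPartitions n)
    (hne : p ≠ q) (hcard : (p.parts.filter fun d => ¬ Even d).card ≤
      (q.parts.filter fun d => ¬ Even d).card) : character h2 p ≠ character h2 q := by
  intro heq
  have hn2 : 2 ≤ n := by
    by_contra hlt
    obtain rfl | rfl : n = 0 ∨ n = 1 := by omega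
    · exact hne (Subsingleton.elim p q)
    · exact hne (Subsingleton.elim p q)
  have h2' := h2 hn2
  set bs := (q.parts.filter fun d => ¬ Even d).toList with hbs
  have hbs1 : ∀ b ∈ bs, 1 ≤ b ∧ ¬ Even b := fun b hb => by
    rw [hbs, Multiset.mem_toList, Multiset.mem_filter] at hb
    exact ⟨q.parts_pos hb.1, hb.2⟩
  have hbs2 : ∀ b ∈ bs, 1 ≤ b := fun b hb => (hbs1 b hb).1
  have hcoe : (bs : Multiset ℕ) = q.parts.filter fun d => ¬ Even d := Multiset.coe_toList _
  have hlen : bs.length = (q.parts.filter fun d => ¬ Even d).card := Multiset.length_toList _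
  have hsum : (q.parts.filter Even).sum + bs.sum = n := by
    rw [hbs, Multiset.sum_toList]
    exact sum_filter_even_add q
  have hrep := isRealizedBy_markElt (𝕜 := 𝕜) hbs2 hsum
  have hx : markElt 𝕜 n (q.parts.filter Even).sum bs ∈ peakAlgebra 𝕜 n :=
    (mem_peakAlgebra 𝕜).2 (markElt_mem_peakSpace 𝕜 _ _)
  have hval : ∀ r : n.Partition, (r.parts.filter fun d => ¬ Even d).card ≤ bs.length →
      character h2 r ⟨_, hx⟩ = veesCoeff 𝕜 bs (r.parts.filter fun d => ¬ Even d) := fun r hr => by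
    rw [character_apply h2 r (x := ⟨_, hx⟩) hrep, peakCoeff_eq 𝕜 _ _ (parts_zero_notMem r),
      if_pos (by rw [r.parts_sum, hsum]), subCoeff_eq 𝕜 bs hbs2 hr]
  -- The eigenvalue at `q` is a product of `2`s and of numbers of at most `n`.
  have hq0 : veesCoeff 𝕜 bs (q.parts.filter fun d => ¬ Even d) ≠ 0 := by
    rw [← hcoe]
    refine veesCoeff_self_ne_zero 𝕜 bs hbs1 h2' fun k hk1 hk2 h0 => hn ?_
    have hle : bs.length ≤ bs.sum := by
      simpa using List.card_nsmul_le_sum bs 1 hbs2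
    have hdvd : k ∣ n.factorial := Nat.dvd_factorial hk1 (by omega)
    obtain ⟨c, hc⟩ := hdvd
    rw [hc, Nat.cast_mul, h0, zero_mul]
  refine hne (almostOdd_ext hp hq ?_)
  rw [← hcoe]
  refine eq_of_veesCoeff_ne_zero 𝕜 bs hbs1 (hlen ▸ hcard) ?_
  rw [← hval p (hlen ▸ hcard), heq, hval q hlen.ge]
  exact hq0

theorem character_injOn (hn : (n.factorial : 𝕜) ≠ 0) (h2 : 2 ≤ n → (2 : 𝕜) ≠ 0) :
    Set.InjOn (character (𝕜 := 𝕜) h2) (almostOddPartitions n) := by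
  intro p hp q hq h
  by_contra hne
  rcases le_total (p.parts.filter fun d => ¬ Even d).card
    (q.parts.filter fun d => ¬ Even d).card with hle | hle
  · exact character_separates hn h2 hp hq hne hle h
  · exact character_separates hn h2 hq hp (Ne.symm hne) hle h.symm

/-! ### The maximal semisimple quotient -/

/-- The characters attached to the almost-odd partitions, as a map to a product of copies of the
field. -/
def characters (h2 : 2 ≤ n → (2 : 𝕜) ≠ 0) :
    peakAlgebra 𝕜 n →ₐ[𝕜] (almostOddPartitions n → 𝕜) :=
  AlgHom.pi fun p => character h2 p.1

/-- The characters are pairwise different, hence linearly independent. -/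
theorem characters_surjective (hn : (n.factorial : 𝕜) ≠ 0) (h2 : 2 ≤ n → (2 : 𝕜) ≠ 0) :
    Function.Surjective (characters (𝕜 := 𝕜) h2) := by
  have hli : LinearIndependent 𝕜 fun p : almostOddPartitions n =>
      (character (𝕜 := 𝕜) h2 p.1 : peakAlgebra 𝕜 n → 𝕜) := by
    have := (linearIndependent_monoidHom (peakAlgebra 𝕜 n) 𝕜).comp
      (fun p : almostOddPartitions n => ((character (𝕜 := 𝕜) h2 p.1 : peakAlgebra 𝕜 n →+* 𝕜) :
        peakAlgebra 𝕜 n →* 𝕜)) fun p q h => Subtype.ext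
          (character_injOn hn h2 p.2 q.2 (AlgHom.ext fun x => DFunLike.congr_fun h x))
    exact this
  change Function.Surjective (characters (𝕜 := 𝕜) h2).toLinearMap
  rw [← LinearMap.range_eq_top]
  by_contra htop
  obtain ⟨f, hf0, hf⟩ := Submodule.exists_le_ker_of_lt_top _ (lt_top_iff_ne_top.2 htop)
  classical
  refine hf0 (LinearMap.pi_ext' fun p => LinearMap.ext_ring ?_)
  refine Fintype.linearIndependent_iff.1 hli (fun p => f (Pi.single p 1)) ?_ p
  funext x
  have h1 : f (characters h2 x) = 0 := hf ⟨x, rfl⟩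
  rw [Pi.zero_apply, ← h1, LinearMap.pi_apply_eq_sum_univ f]
  simp only [Finset.sum_apply, Pi.smul_apply, smul_eq_mul]
  refine Finset.sum_congr rfl fun p _ => ?_
  rw [mul_comm]
  congr 2
  funext i
  simp [Pi.single_apply, eq_comm]

/-- An element killed by the characters of the almost-odd partitions has no nonzero eigenvalue:
every multiset of degrees with sum `n` has the odd members of an almost-odd partition. -/
theorem pow_eq_zero_of_characters_eq_zero (h2 : 2 ≤ n → (2 : 𝕜) ≠ 0) {x : peakAlgebra 𝕜 n}
    (hx : characters h2 x = 0) : x ^ (n + 1) = 0 := by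
  obtain ⟨g, c, h⟩ := exists_isRealizedBy h2 ((mem_peakAlgebra 𝕜).1 x.2)
  refine Subtype.ext (h.pow_eq_zero fun m h0 => ?_)
  by_cases hm : m.sum = n
  · obtain ⟨p, hp, hodd, -⟩ := exists_almostOdd (n := n) (o := m.filter fun d => ¬ Even d)
      (fun d hd => (Multiset.mem_filter.1 hd).2) (even_sum_filter_even m)
      (by rw [← Multiset.sum_add, Multiset.filter_add_not, hm])
    rw [h.eq_of_odd m p.parts h0 (parts_zero_notMem p) hm p.parts_sum hodd.symm,
      ← character_apply h2 p h]
    exact congrFun hx ⟨p, hp⟩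
  · exact h.eq_zero m h0 hm

theorem jacobson_eq_ker (hn : (n.factorial : 𝕜) ≠ 0) (h2 : 2 ≤ n → (2 : 𝕜) ≠ 0) :
    Ring.jacobson (peakAlgebra 𝕜 n) = RingHom.ker (characters (𝕜 := 𝕜) h2) := by
  refine le_antisymm ?_ fun x hx => ?_
  · have : RingHomSurjective (characters (𝕜 := 𝕜) h2).toRingHom :=
      ⟨characters_surjective hn h2⟩
    have h := Ring.le_comap_jacobson (characters (𝕜 := 𝕜) h2).toRingHom
    rw [IsSemisimpleRing.jacobson_eq_bot (almostOddPartitions n → 𝕜)] at h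
    exact h
  · rw [← Ideal.jacobson_bot, Ideal.mem_jacobson_iff]
    intro y
    have hy : characters h2 (y * x) = 0 := by
      rw [map_mul, (RingHom.mem_ker.1 hx : characters h2 x = 0), mul_zero]
    have hu : IsUnit (y * x + 1) :=
      IsNilpotent.isUnit_add_one ⟨_, pow_eq_zero_of_characters_eq_zero h2 hy⟩
    obtain ⟨u, hu⟩ := hu
    refine ⟨↑u⁻¹, ?_⟩
    rw [Submodule.mem_bot, mul_assoc, ← mul_add_one, ← hu, Units.inv_mul, sub_self]

theorem finrank_quotient_jacobson (hn : (n.factorial : 𝕜) ≠ 0) (h2 : 2 ≤ n → (2 : 𝕜) ≠ 0) :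
    Module.finrank 𝕜 (peakAlgebra 𝕜 n ⧸ Ring.jacobson (peakAlgebra 𝕜 n)) =
      (almostOddPartitions n).card := by
  have h1 : (Ring.jacobson (peakAlgebra 𝕜 n)).restrictScalars 𝕜 =
      LinearMap.ker (characters (𝕜 := 𝕜) h2).toLinearMap := by
    rw [jacobson_eq_ker hn h2]
    rfl
  have e := (Submodule.Quotient.restrictScalarsEquiv 𝕜 (Ring.jacobson (peakAlgebra 𝕜 n))).symm ≪≫ₗ
    Submodule.quotEquivOfEq _ _ h1 ≪≫ₗ
      LinearMap.quotKerEquivOfSurjective _ (characters_surjective hn h2)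
  rw [e.finrank_eq, Module.finrank_fintype_fun_eq_card, Fintype.card_coe]

end Characters

end PeakAlgebra

theorem corollary3p3 (𝕜 : Type*) [Field 𝕜] (n : ℕ) (hn : (n.factorial : 𝕜) ≠ 0) :
    (PeakAlgebra.peakAlgebra 𝕜 n).toSubmodule = PeakAlgebra.peakSpace 𝕜 n ∧
    IsLeast {I : Ideal (PeakAlgebra.peakAlgebra 𝕜 n) |
        ∃ _ : I.IsTwoSided, IsSemisimpleRing (PeakAlgebra.peakAlgebra 𝕜 n ⧸ I)}
      (Ring.jacobson (PeakAlgebra.peakAlgebra 𝕜 n)) ∧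
    Module.finrank 𝕜
        (PeakAlgebra.peakAlgebra 𝕜 n ⧸ Ring.jacobson (PeakAlgebra.peakAlgebra 𝕜 n)) =
      (PeakAlgebra.almostOddPartitions n).card ∧
    Module.finrank 𝕜
        (PeakAlgebra.peakAlgebra 𝕜 n ⧸ Ring.jacobson (PeakAlgebra.peakAlgebra 𝕜 n)) =
      ∑ j ∈ Finset.range (n / 2 + 1), (Nat.Partition.odds (n - 2 * j)).card := by
  have h2 : 2 ≤ n → (2 : 𝕜) ≠ 0 := fun h h0 => hn <| by
    obtain ⟨c, hc⟩ := Nat.dvd_factorial two_pos h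
    rw [hc, Nat.cast_mul, Nat.cast_two, h0, zero_mul]
  have hfin := PeakAlgebra.finrank_quotient_jacobson hn h2
  refine ⟨PeakAlgebra.peakAlgebra_toSubmodule 𝕜, ⟨⟨inferInstance, ?_⟩, ?_⟩, hfin,
    hfin.trans (PeakAlgebra.card_almostOdd n)⟩
  · have : IsArtinianRing (PeakAlgebra.peakAlgebra 𝕜 n) := IsArtinianRing.of_finite 𝕜 _
    exact IsSemiprimaryRing.isSemisimpleRing
  · rintro I ⟨_, hI⟩
    exact Ring.jacobson_le_of_eq_bot (IsSemisimpleRing.jacobson_eq_bot _)
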